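/- Let $D=\{z\in\mathbb C:|z|<1\}$ and let $\lambda$ be the Haar probability measure on the unit circle $\mathbb T$. The Nevanlinna class $\mathcal N$ consists of the analytic functions $f$ on $D$ with $\sup_{0\le r<1}\int_{\mathbb T}\log^+|f(r\zeta)|\,d\lambda(\zeta)<\infty$; each such $f$ has a radial boundary function $\tilde f(\zeta)=\lim_{r\to1^-}f(r\zeta)$ for $\lambda$-almost every $\zeta$. The Smirnov class $\mathcal N^+$ consists of the $f\in\mathcal N$ with $\sup_{0\le r<1}\int_{\mathbb T}\log^+|f(r\zeta)|\,d\lambda(\zeta)=\int_{\mathbb T}\log^+|\tilde f|\,d\lambda$. A singular inner function is an analytic function $s$ on $D$ without zeros such that $|s|\le 1$ on $D$ and $|\tilde s|=1$ $\lambda$-almost everywhere. A Blaschke product is a function $b(z)=z^{\rho(0)}\prod_{w\in D\setminus\{0\}}\bigl(\frac{|w|}{w}\frac{w-z}{1-\bar w z}\bigr)^{\rho(w)}$ on $D$ with $\rho:D\to\mathbb Z_{\ge0}$ and $\sum_{w\in D}(1-|w|)\rho(w)<\infty$. An outer function is a function $\mathfrak o(z)=\omega\exp\int_{\mathbb T}\frac{\zeta+z}{\zeta-z}\psi(\zeta)\,d\lambda(\zeta)$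 on $D$ with $|\omega|=1$ and a real-valued $\psi\in L^1(\mathbb T,\lambda)$. Let $N\ge2$ be an integer and let $f\in\mathcal N$, $f\ne0$, satisfy $$f(z^N)^N=\prod_{\zeta^N=1}f(\zeta z)\qquad\text{for all } z\in D .$$ Then: 1. There is a unique constant $c>0$ such that $cf$ is a quotient of two singular inner functions. 2. If in addition $f\in\mathcal N^+$, there is a unique constant $c>0$ such that $cf$ is a singular inner function. 3. If $f=b\,\frac{s_1}{s_2}\,\mathfrak o$ on $D$ with a Blaschke product $b$, singular inner functions $s_1,s_2$ and an outer function $\mathfrak o$, then $b=1$ and $\mathfrak o$ is constant. -/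

import Mathlib

namespace DiscFunction

open Filter Topology MeasureTheory Real

/-- The open unit disc `D`. -/
abbrev disc : Set ℂ := Metric.ball 0 1

/-- `g` is (a version of) the boundary function of `f`: `g ζ` is the radial limit of `f` at `ζ`
for almost every `ζ = exp (iθ)` on the unit circle. -/
def IsBoundaryFunction (f g : ℂ → ℂ) : Prop :=
  ∀ᵐ θ : ℝ, Tendsto (fun r : ℝ => f (circleMap 0 r θ)) (𝓝[<] 1) (𝓝 (g (circleMap 0 1 θ)))

/-- The circular means of `log⁺ |f|` over the circles of radius `r`, `0 ≤ r < 1`. -/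
def posLogMeans (f : ℂ → ℂ) : Set ℝ :=
  (fun r : ℝ => circleAverage (fun z => posLog ‖f z‖) 0 r) '' Set.Ico 0 1

/-- The Nevanlinna class. -/
def Nevanlinna (f : ℂ → ℂ) : Prop :=
  DifferentiableOn ℂ f disc ∧ BddAbove (posLogMeans f)

/-- The Smirnov class: functions in the Nevanlinna class for which the supremum of the means of
`log⁺ |f|` is the mean of `log⁺` of the modulus of the boundary function. -/
def Smirnov (f : ℂ → ℂ) : Prop :=
  Nevanlinna f ∧ ∃ g : ℂ → ℂ, IsBoundaryFunction f g ∧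
    CircleIntegrable (fun ζ => posLog ‖g ζ‖) 0 1 ∧
    IsLUB (posLogMeans f) (circleAverage (fun ζ => posLog ‖g ζ‖) 0 1)

/-- Inner functions. -/
def IsInner (f : ℂ → ℂ) : Prop :=
  DifferentiableOn ℂ f disc ∧ (∀ z ∈ disc, ‖f z‖ ≤ 1) ∧
    ∃ g : ℂ → ℂ, IsBoundaryFunction f g ∧ ∀ᵐ θ : ℝ, ‖g (circleMap 0 1 θ)‖ = 1

/-- Singular inner functions: inner functions without zeros in the disc. -/
def IsSingularInner (f : ℂ → ℂ) : Prop :=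
  IsInner f ∧ ∀ z ∈ disc, f z ≠ 0

/-- Quotients of two singular inner functions (as functions on the disc). -/
def IsSingularInnerQuotient (f : ℂ → ℂ) : Prop :=
  ∃ s₁ s₂ : ℂ → ℂ, IsSingularInner s₁ ∧ IsSingularInner s₂ ∧ ∀ z ∈ disc, f z = s₁ z / s₂ z

/-- Blaschke products, with the multiplicity function `ρ` (only its values on the disc matter)
subject to the Blaschke condition. The product is over all points `w ≠ 0` of the disc. -/
def IsBlaschkeProduct (b : ℂ → ℂ) : Prop :=
  ∃ ρ : ℂ → ℕ, Summable (fun w : disc => (1 - ‖(w : ℂ)‖) * (ρ w : ℝ)) ∧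
    ∀ z ∈ disc, b z = z ^ ρ 0 * ∏' w : {w : ℂ // w ∈ disc ∧ w ≠ 0},
      ((‖(w : ℂ)‖ : ℂ) / w * ((w - z) / (1 - (starRingEnd ℂ) w * z))) ^ ρ w

/-- Outer functions: `ω exp (∫ (ζ + z) / (ζ - z) ψ(ζ) dλ(ζ))` with `|ω| = 1`, `ψ` real-valued and
integrable over the circle with respect to its normalized Lebesgue measure `λ`. -/
def IsOuter (o : ℂ → ℂ) : Prop :=
  ∃ ω : ℂ, ‖ω‖ = 1 ∧ ∃ ψ : ℂ → ℝ, CircleIntegrable ψ 0 1 ∧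
    ∀ z ∈ disc, o z = ω * Complex.exp (circleAverage (fun ζ => (ζ + z) / (ζ - z) * (ψ ζ : ℂ)) 0 1)

/-- The functional equation `f(z^N)^N = ∏_{ζ^N = 1} f(ζ z)` on the disc. -/
def SatisfiesFunctionalEquation (N : ℕ) (f : ℂ → ℂ) : Prop :=
  ∀ z ∈ disc, f (z ^ N) ^ N = ∏ ζ ∈ Polynomial.nthRootsFinset N (1 : ℂ), f (ζ * z)

end DiscFunction

namespace DiscFunction

open Filter Topology MeasureTheory Real

/-! The functional equation forces `log |f|` to have constant boundary values. Suppose first that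
`f` has no zeros and write `f = exp h`. Taking logarithms of moduli and passing to radial limits,
the boundary function `ψ = log |f̃|` satisfies `N ψ(ζ^N) = ∑ ψ(ωζ)` over the `N`-th roots of unity
`ω`. On Fourier coefficients this says `c(Nm) = c(m)`, hence `c(n) = c(N^j n)` for all `j`; by the
Riemann–Lebesgue lemma `c(n) = 0` for `n ≠ 0` (`circleCoeff_eq_zero`). So the outer part of `f` is a
constant.

Zeros are excluded by `ne_zero_of_functionalEquation`: at `0` the two sides would vanish to
different orders, and a zero `w ≠ 0` would produce zeros `w^(N^j)` accumulating at `0`.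

The canonical factorization is replaced by differences of positive harmonic functions. The
Nevanlinna condition gives a majorant `Re H` of `max (Re h) 0` (`exists_majorant`), so `H` and `H -
h` have nonnegative real part. Such a real part has integrable radial limits whose Poisson integral
lies below it (`exists_boundary_re`); the exponential of minus the difference is singular inner. The
quotient of the two functions so obtained is `f` up to a positive constant. Radial limits come from
Fatou's theorem, proved by moving an angular derivative onto the Poisson kernel.

The constant is determined because `|f̃| = c⁻¹` almost everywhere. In the Smirnov case the means do
not exceed the boundary mean, which forces convergence in `L¹` and hence `|f| ≤ c⁻¹`
(`norm_le_of_smirnov`). In a factorization of `f`, the Blaschke factor has no zeros and the outer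
factor has constant boundary modulus, so both are trivial. -/

/-! ### The Poisson kernel in polar coordinates and Fatou's theorem. -/

/-- The Poisson kernel of the disc in polar coordinates. -/
noncomputable def polarPoisson (r t : ℝ) : ℝ := (1 - r ^ 2) / (1 - 2 * r * cos t + r ^ 2)

/-- The derivative of the polar Poisson kernel in the angle. -/
noncomputable def polarPoissonDeriv (r t : ℝ) : ℝ :=
  -((1 - r ^ 2) * (2 * r * sin t)) / (1 - 2 * r * cos t + r ^ 2) ^ 2

lemma polarPoisson_denom_pos {r : ℝ} (h0 : 0 ≤ r) (h1 : r < 1) (t : ℝ) :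
    0 < 1 - 2 * r * cos t + r ^ 2 := by
  nlinarith [cos_le_one t, sq_pos_of_pos (sub_pos.2 h1),
    mul_nonneg h0 (sub_nonneg.2 (cos_le_one t))]

lemma hasDerivAt_polarPoisson {r : ℝ} (h0 : 0 ≤ r) (h1 : r < 1) (t : ℝ) :
    HasDerivAt (polarPoisson r) (polarPoissonDeriv r t) t := by
  have hd : HasDerivAt (fun t => 1 - 2 * r * cos t + r ^ 2) (2 * r * sin t) t := by
    have := (((hasDerivAt_cos t).const_mul (2 * r)).const_sub 1).add_const (r ^ 2)
    simpa using this
  have := (hasDerivAt_const t (1 - r ^ 2)).div hd (polarPoisson_denom_pos h0 h1 t).ne'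
  convert! this using 1
  simp [polarPoissonDeriv]

lemma continuous_polarPoissonDeriv {r : ℝ} (h0 : 0 ≤ r) (h1 : r < 1) :
    Continuous (polarPoissonDeriv r) := by
  unfold polarPoissonDeriv
  refine Continuous.div (by fun_prop) (by fun_prop) fun t => ?_
  exact (pow_pos (polarPoisson_denom_pos h0 h1 t) 2).ne'

lemma poissonKernel_circleMap (r θ t : ℝ) :
    poissonKernel 0 (circleMap 0 r θ) (circleMap 0 1 t) = polarPoisson r (t - θ) := by
  have h2 : ‖circleMap 0 1 t - circleMap 0 r θ‖ ^ 2 = 1 - 2 * r * cos (t - θ) + r ^ 2 := by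
    rw [← Complex.normSq_eq_norm_sq, Complex.normSq_apply]
    simp [circleMap, Complex.exp_re, Complex.exp_im, cos_sub]
    nlinarith [sin_sq_add_cos_sq t, sin_sq_add_cos_sq θ, sin_sq_add_cos_sq t]
  simp only [poissonKernel, sub_zero, h2, polarPoisson, norm_circleMap_zero, sq_abs, one_pow]

lemma circleAverage_poissonKernel {z : ℂ} (hz : z ∈ disc) :
    circleAverage (fun ζ => poissonKernel 0 z ζ) 0 1 = 1 := by
  have h := (diffContOnCl_const (c := (1 : ℂ)) (s := Metric.ball (0 : ℂ) 1) (𝕜 := ℂ)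
    ).circleAverage_poissonKernel_smul hz
  have e : (poissonKernel 0 z • fun _ => (1 : ℂ)) = fun ζ => ((poissonKernel 0 z ζ : ℝ) : ℂ) := by
    ext ζ; simp
  rw [e, circleAverage_def, intervalIntegral.integral_ofReal, Complex.real_smul] at h
  rw [circleAverage_def, smul_eq_mul]
  exact_mod_cast h

lemma circleAverage_eq_integral_shift {E : Type*} [NormedAddCommGroup E] [NormedSpace ℝ E]
    (k : ℂ → E) (θ : ℝ) :
    circleAverage k 0 1 = (2 * π)⁻¹ • ∫ s in (-π)..π, k (circleMap 0 1 (θ + s)) := by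
  rw [circleAverage_def]
  congr 1
  have hp : Function.Periodic (fun s => k (circleMap 0 1 s)) (2 * π) :=
    fun s => by simp only [periodic_circleMap 0 1 s]
  have h := hp.intervalIntegral_add_eq 0 (θ - π)
  rw [zero_add] at h
  rw [h, intervalIntegral.integral_comp_add_left (fun s => k (circleMap 0 1 s)) θ]
  congr 1; ring

lemma circleAverage_poissonKernel_smul_eq {E : Type*} [NormedAddCommGroup E] [NormedSpace ℝ E]
    (k : ℂ → E) (r θ : ℝ) :
    circleAverage (fun ζ => poissonKernel 0 (circleMap 0 r θ) ζ • k ζ) 0 1 =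
      (2 * π)⁻¹ • ∫ s in (-π)..π, polarPoisson r s • k (circleMap 0 1 (θ + s)) := by
  rw [circleAverage_eq_integral_shift _ θ]
  simp [poissonKernel_circleMap]

lemma circleMap_mem_disc {r : ℝ} (h0 : 0 ≤ r) (h1 : r < 1) (θ : ℝ) : circleMap 0 r θ ∈ disc := by
  simp [disc, abs_of_nonneg h0, h1]

lemma integral_polarPoisson {r : ℝ} (h0 : 0 ≤ r) (h1 : r < 1) :
    ∫ s in (-π)..π, polarPoisson r s = 2 * π := by
  have h := circleAverage_poissonKernel (circleMap_mem_disc h0 h1 0)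
  have h' := circleAverage_poissonKernel_smul_eq (fun _ => (1 : ℝ)) r 0
  simp only [smul_eq_mul, mul_one] at h'
  rw [h] at h'
  field_simp at h'
  linarith

lemma polarPoisson_pi (r : ℝ) : polarPoisson r π = (1 - r ^ 2) / (1 + r) ^ 2 := by
  simp [polarPoisson]; ring

lemma polarPoisson_neg (r t : ℝ) : polarPoisson r (-t) = polarPoisson r t := by
  simp [polarPoisson]

lemma tendsto_polarPoisson_pi : Tendsto (fun r => polarPoisson r π) (𝓝[<] 1) (𝓝 0) := by
  have : ContinuousAt (fun r : ℝ => (1 - r ^ 2) / (1 + r) ^ 2) 1 :=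
    ContinuousAt.div (by fun_prop) (by fun_prop) (by norm_num)
  have h := this.tendsto
  norm_num at h
  simp only [polarPoisson_pi]
  exact h.mono_left nhdsWithin_le_nhds

lemma integral_polarPoissonDeriv {r : ℝ} (h0 : 0 ≤ r) (h1 : r < 1) :
    ∫ s in (-π)..π, polarPoissonDeriv r s = 0 := by
  rw [intervalIntegral.integral_eq_sub_of_hasDerivAt
    (fun t _ => hasDerivAt_polarPoisson h0 h1 t)
    ((continuous_polarPoissonDeriv h0 h1).intervalIntegrable _ _), polarPoisson_neg, sub_self]

/-- Integration by parts. With the next two lemmas and `tendsto_polarPoisson_pi` it shows that `-s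
P_r'(s) / 2π` is a nonnegative approximate identity as `r → 1`; the deficit `P_r(π)` is the boundary
term. -/
lemma integral_mul_polarPoissonDeriv {r : ℝ} (h0 : 0 ≤ r) (h1 : r < 1) :
    ∫ s in (-π)..π, (2 * π)⁻¹ * (-(s * polarPoissonDeriv r s)) = 1 - polarPoisson r π := by
  rw [intervalIntegral.integral_const_mul, intervalIntegral.integral_neg]
  have h := intervalIntegral.integral_mul_deriv_eq_deriv_mul (a := -π) (b := π)
    (u := fun s : ℝ => s) (u' := fun _ => 1) (v := polarPoisson r) (v' := polarPoissonDeriv r)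
    (fun s _ => hasDerivAt_id' s) (fun s _ => hasDerivAt_polarPoisson h0 h1 s)
    (by simp) ((continuous_polarPoissonDeriv h0 h1).intervalIntegrable _ _)
  simp only [one_mul] at h
  rw [h, integral_polarPoisson h0 h1, polarPoisson_neg]
  field_simp
  ring

lemma mul_polarPoissonDeriv_nonpos {r s : ℝ} (h0 : 0 ≤ r) (h1 : r < 1) (hs : s ∈ Set.Icc (-π) π) :
    s * polarPoissonDeriv r s ≤ 0 := by
  have : 0 ≤ s * sin s := by
    rcases le_total 0 s with h | h
    · exact mul_nonneg h (sin_nonneg_of_nonneg_of_le_pi h hs.2)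
    · exact mul_nonneg_of_nonpos_of_nonpos h (sin_nonpos_of_nonpos_of_neg_pi_le h hs.1)
  have h2 : 0 ≤ 1 - r ^ 2 := by nlinarith
  rw [polarPoissonDeriv, mul_div_assoc']
  apply div_nonpos_of_nonpos_of_nonneg _ (sq_nonneg _)
  have : 0 ≤ ((1 - r ^ 2) * (2 * r)) * (s * sin s) := by positivity
  linarith

/-- The denominator of the Poisson kernel is `(1 - r)² + 2r(1 - cos s)`, which is at least `1 - cos
δ` once `2r ≥ 1`. The factor `1 - r²` then gives uniform decay away from `0`. -/
lemma abs_mul_polarPoissonDeriv_le {r s δ : ℝ} (h0 : 1 / 2 ≤ r) (h1 : r < 1)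
    (hs : s ∈ Set.Icc (-π) π) (hδ : 0 < δ) (hδs : δ ≤ |s|) :
    |s * polarPoissonDeriv r s| ≤ π * (2 * (1 - r ^ 2)) / (1 - cos δ) ^ 2 := by
  have hsp : |s| ≤ π := abs_le.2 hs
  have hcs : cos s ≤ cos δ := by
    rw [← cos_abs s]
    exact cos_le_cos_of_nonneg_of_le_pi hδ.le hsp hδs
  have hc : 0 < 1 - cos δ := by
    have := cos_lt_cos_of_nonneg_of_le_pi le_rfl (hδs.trans hsp) hδ
    simp at this; linarith
  have hden : 1 - cos δ ≤ 1 - 2 * r * cos s + r ^ 2 := by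
    nlinarith [sq_nonneg (1 - r), mul_le_mul_of_nonneg_left hcs (by linarith : 0 ≤ 2 * r)]
  have h2 : 0 ≤ 1 - r ^ 2 := by nlinarith
  rw [abs_mul, polarPoissonDeriv, abs_div, abs_neg, abs_mul, abs_mul, abs_of_nonneg h2,
    abs_of_nonneg (by linarith : 0 ≤ 2 * r), abs_sq, mul_div_assoc π,
    mul_comm 2 (1 - r ^ 2)]
  have h3 : 2 * r * |sin s| ≤ 2 := by
    nlinarith [abs_sin_le_one s, abs_nonneg (sin s)]
  gcongr

/-- **Fatou's theorem**, differentiated form: the angular derivative of the Poisson integral of `G`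
tends radially to the derivative of `G`. -/
theorem tendsto_integral_polarPoissonDeriv {E : Type*} [NormedAddCommGroup E] [NormedSpace ℝ E]
    [CompleteSpace E] {G : ℝ → E} (hG : Continuous G) {θ : ℝ} {a : E} (ha : HasDerivAt G a θ) :
    Tendsto (fun r => (2 * π)⁻¹ • ∫ s in (-π)..π, (-polarPoissonDeriv r s) • G (θ + s))
      (𝓝[<] 1) (𝓝 a) := by
  have hr : ∀ᶠ r : ℝ in 𝓝[<] 1, r ∈ Set.Ioo (1 / 2) 1 := Ioo_mem_nhdsLT (by norm_num)
  -- As `P_r'` has integral zero, `G θ` may be subtracted from `G (θ + s)`. Writing the difference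
  -- as `s • q s` turns the kernel into the approximate identity `-s P_r'(s) / 2π`, acting on a
  -- function with limit `a` at `0`.
  set q : ℝ → E := fun s => s⁻¹ • (G (θ + s) - G θ) with hq
  have hqlim : Tendsto q (𝓝[≠] 0) (𝓝 a) := by
    have := hasDerivAt_iff_tendsto_slope_zero.1 ha
    simpa [hq] using this
  have hpi := pi_pos
  -- The null point `0` is removed because `q` is controlled there only through its punctured limit.
  set s₀ : Set ℝ := Set.Ioc (-π) π \ {0} with hs₀
  have hms : MeasurableSet s₀ := measurableSet_Ioc.diff (measurableSet_singleton 0)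
  have hqint : IntegrableOn q s₀ := by
    have hcont : ContinuousOn q s₀ := by
      intro x hx
      have hx0 : x ≠ 0 := hx.2
      exact ContinuousAt.continuousWithinAt (by simp only [hq]; fun_prop (disch := assumption))
    obtain ⟨u, hu, hub⟩ := Metric.mem_nhdsWithin_iff.1 (hqlim (Metric.ball_mem_nhds a one_pos))
    obtain ⟨C, hC⟩ := (isCompact_Icc (a := -π) (b := π)).exists_bound_of_continuousOn
      (f := fun s => G (θ + s) - G θ) (by fun_prop)
    have hbound : ∀ x ∈ s₀, ‖q x‖ ≤ max (‖a‖ + 1) (u⁻¹ * C) := by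
      intro x hx
      by_cases hxu : |x| < u
      · have : q x ∈ Metric.ball a 1 := hub ⟨by simpa using hxu, hx.2⟩
        have := norm_le_norm_add_norm_sub' (q x) a
        rw [mem_ball_iff_norm] at *
        exact le_max_of_le_left (by linarith)
      · apply le_max_of_le_right
        rw [hq, norm_smul, norm_inv, Real.norm_eq_abs]
        have := hC x (Set.Ioc_subset_Icc_self hx.1)
        have hC0 : 0 ≤ C := (norm_nonneg _).trans this
        gcongr
        linarith
    exact IntegrableOn.of_bound ((measure_mono Set.sdiff_subset).trans_lt measure_Ioc_lt_top)
      (hcont.aestronglyMeasurable hms) (max (‖a‖ + 1) (u⁻¹ * C))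
      ((ae_restrict_iff' hms).2 (ae_of_all _ hbound))
  have key := tendsto_setIntegral_peak_smul_of_integrableOn_of_tendsto (μ := volume) (x₀ := 0)
    (l := 𝓝[<] (1 : ℝ)) (s := s₀) (t := s₀) (g := q) (a := a)
    (φ := fun r s => (2 * π)⁻¹ * (-(s * polarPoissonDeriv r s))) hms hms subset_rfl
    self_mem_nhdsWithin ((measure_mono Set.sdiff_subset).trans_lt measure_Ioc_lt_top).ne ?_ ?_ ?_ ?_
    hqint (hqlim.mono_left (nhdsWithin_mono _ fun x hx => hx.2))
  · refine key.congr' ?_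
    filter_upwards [hr] with r hr
    have h0 : 0 ≤ r := by linarith [hr.1]
    have e : ∀ k : ℝ → E, ∫ x in s₀, k x = ∫ x in (-π)..π, k x := fun k => by
      rw [intervalIntegral.integral_of_le (by linarith)]
      exact setIntegral_congr_set (sdiff_null_ae_eq_self (measure_singleton 0))
    have hI : IntervalIntegrable (fun s => (-polarPoissonDeriv r s) • G θ) volume (-π) π :=
      ((continuous_polarPoissonDeriv h0 hr.2).neg.smul continuous_const).intervalIntegrable _ _
    have hI' : IntervalIntegrable (fun s => (-polarPoissonDeriv r s) • G (θ + s)) volume (-π) π :=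
      ((continuous_polarPoissonDeriv h0 hr.2).neg.smul (by fun_prop)).intervalIntegrable _ _
    have hz : ∫ s in (-π)..π, (-polarPoissonDeriv r s) • G θ = 0 := by
      rw [intervalIntegral.integral_smul_const, intervalIntegral.integral_neg,
        integral_polarPoissonDeriv h0 hr.2]; simp
    rw [← sub_zero (∫ s in (-π)..π, (-polarPoissonDeriv r s) • G (θ + s)), ← hz,
      ← intervalIntegral.integral_sub hI' hI, ← e, ← integral_smul]
    refine setIntegral_congr_fun hms fun x hx => ?_
    have hx0 : x ≠ 0 := hx.2
    simp only [hq, ← smul_sub, smul_smul]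
    congr 1
    field_simp
  · filter_upwards [hr] with r hr x hx
    have := mul_polarPoissonDeriv_nonpos (by linarith [hr.1]) hr.2 (Set.Ioc_subset_Icc_self hx.1)
    have : 0 ≤ -(x * polarPoissonDeriv r x) := by linarith
    positivity
  · intro u hu h0u
    obtain ⟨δ, hδ, hδu⟩ := Metric.isOpen_iff.1 hu 0 h0u
    rw [Metric.tendstoUniformlyOn_iff]
    intro ε hε
    have hlim : Tendsto (fun r : ℝ => (2 * π)⁻¹ * (π * (2 * (1 - r ^ 2)) / (1 - cos δ) ^ 2))
        (𝓝[<] 1) (𝓝 0) := by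
      have : Continuous (fun r : ℝ => (2 * π)⁻¹ * (π * (2 * (1 - r ^ 2)) / (1 - cos δ) ^ 2)) := by
        fun_prop
      have h := this.tendsto 1
      simp only [one_pow, sub_self, mul_zero, zero_div] at h
      exact h.mono_left nhdsWithin_le_nhds
    filter_upwards [hr, hlim.eventually_lt_const hε] with r hr hlt x hx
    have hxδ : δ ≤ |x| := by
      by_contra h
      exact hx.2 (hδu (by simpa using not_le.1 h))
    have := abs_mul_polarPoissonDeriv_le hr.1.le hr.2 (Set.Ioc_subset_Icc_self hx.1.1) hδ hxδ
    simp only [Pi.zero_apply, dist_zero_left, norm_mul, norm_neg, Real.norm_eq_abs, ← abs_mul]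
    refine lt_of_le_of_lt ?_ hlt
    rw [abs_mul, abs_of_pos (by positivity)]
    gcongr
  · have h : Tendsto (fun r => 1 - polarPoisson r π) (𝓝[<] 1) (𝓝 1) := by
      simpa using tendsto_polarPoisson_pi.const_sub 1
    refine h.congr' ?_
    filter_upwards [hr] with r hr
    rw [← integral_mul_polarPoissonDeriv (by linarith [hr.1]) hr.2,
      intervalIntegral.integral_of_le (by linarith)]
    exact (setIntegral_congr_set (sdiff_null_ae_eq_self (measure_singleton 0))).symm
  · filter_upwards [hr] with r hr
    exact (continuous_const.mul (continuous_id.mul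
      (continuous_polarPoissonDeriv (by linarith [hr.1]) hr.2)).neg).aestronglyMeasurable

lemma periodic_comp_circleMap {E : Type*} (k : ℂ → E) :
    Function.Periodic (fun s => k (circleMap 0 1 s)) (2 * π) :=
  fun s => by simp only [periodic_circleMap 0 1 s]

lemma intervalIntegrable_comp_circleMap {E : Type*} [NormedAddCommGroup E]
    {k : ℂ → E} (hk : CircleIntegrable k 0 1) (a b : ℝ) :
    IntervalIntegrable (fun s => k (circleMap 0 1 s)) volume a b :=
  (periodic_comp_circleMap k).intervalIntegrable₀ two_pi_pos.ne' hk a b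

/-- **Fatou's theorem** for Poisson integrals of integrable functions. -/
theorem ae_tendsto_circleAverage_poissonKernel {ψ : ℂ → ℝ} (hψ : CircleIntegrable ψ 0 1) :
    ∀ᵐ θ : ℝ, Tendsto
      (fun r => circleAverage (fun ζ => poissonKernel 0 (circleMap 0 r θ) ζ * ψ ζ) 0 1)
      (𝓝[<] 1) (𝓝 (ψ (circleMap 0 1 θ))) := by
  set g : ℝ → ℝ := fun t => ψ (circleMap 0 1 t) with hg
  have hgi := intervalIntegrable_comp_circleMap hψ
  have hloc : LocallyIntegrable g volume := by
    intro x
    refine ⟨Set.Icc (x - 1) (x + 1), Icc_mem_nhds (by linarith) (by linarith), ?_⟩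
    exact (intervalIntegrable_iff_integrableOn_Icc_of_le (by linarith)).1 (hgi _ _)
  filter_upwards [LocallyIntegrable.ae_hasDerivAt_integral hloc] with θ hθ
  set k : ℝ → ℝ := fun s => g (θ + s) with hk
  have hki : ∀ a b, IntervalIntegrable k volume a b := fun a b => by
    simpa using (hgi (θ + a) (θ + b)).comp_add_left θ
  set K : ℝ → ℝ := fun s => ∫ u in (0 : ℝ)..s, k u with hK
  have hKG : ∀ s, K s = ∫ u in θ..(θ + s), g u := fun s => by
    simp only [hK, hk]
    rw [intervalIntegral.integral_comp_add_left g θ, add_zero]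
  have hKc : Continuous K := intervalIntegral.continuous_primitive hki 0
  have hKd : HasDerivAt K (g θ) 0 := by
    have h1 : HasDerivAt (fun x => ∫ t in θ..x, g t) (g θ) (θ + 0) := by simpa using hθ θ
    have := h1.comp_const_add θ 0
    exact this.congr_of_eventuallyEq (Eventually.of_forall hKG)
  have hlim := tendsto_integral_polarPoissonDeriv hKc hKd
  -- The primitive `K` need not be periodic, so integration by parts leaves the boundary term
  -- `P_r(π) (K π - K (-π))`, which vanishes in the limit.
  have hlim2 := (tendsto_polarPoisson_pi.mul_const ((2 * π)⁻¹ * (K π - K (-π)))).add hlim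
  rw [zero_mul, zero_add] at hlim2
  refine hlim2.congr' ?_
  filter_upwards [(Ioo_mem_nhdsLT (by norm_num) : Set.Ioo (1 / 2 : ℝ) 1 ∈ 𝓝[<] 1)] with r hr
  have h0 : 0 ≤ r := by linarith [hr.1]
  have hmem : (0 : ℝ) ∈ Set.uIcc (-π) π := by
    rw [Set.uIcc_of_le (by linarith [pi_pos])]; constructor <;> linarith [pi_pos]
  -- `K` is differentiable only almost everywhere, so the integration by parts has to be the
  -- absolutely continuous one.
  have hac : AbsolutelyContinuousOnInterval K (-π) π :=
    (hki (-π) π).absolutelyContinuousOnInterval_intervalIntegral hmem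
  have hPac : AbsolutelyContinuousOnInterval (polarPoisson r) (-π) π := by
    apply ContDiffOn.absolutelyContinuousOnInterval
    apply ContDiff.contDiffOn
    unfold polarPoisson
    exact ContDiff.div (by fun_prop) (by fun_prop) fun t => (polarPoisson_denom_pos h0 hr.2 t).ne'
  have hparts := hPac.integral_mul_deriv_eq_deriv_mul hac
  have e1 : ∫ s in (-π)..π, polarPoisson r s * deriv K s
      = ∫ s in (-π)..π, polarPoisson r s * k s := by
    apply intervalIntegral.integral_congr_ae
    filter_upwards [(hki (-π) π).ae_hasDerivAt_integral] with s hs hs'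
    rw [(hs (Set.uIoc_subset_uIcc hs') 0 hmem).deriv]
  have hd : deriv (polarPoisson r) = polarPoissonDeriv r :=
    funext fun s => (hasDerivAt_polarPoisson h0 hr.2 s).deriv
  have e2 := circleAverage_poissonKernel_smul_eq ψ r θ
  simp only [smul_eq_mul] at e2
  rw [e2]
  rw [e1, hd, polarPoisson_neg] at hparts
  change _ = (2 * π)⁻¹ * ∫ s in (-π)..π, polarPoisson r s * k s
  rw [hparts]
  simp only [smul_eq_mul, zero_add, neg_mul, intervalIntegral.integral_neg]
  ring

/-! ### Radial limits of bounded analytic functions. -/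

lemma exists_isBoundaryFunction {F : ℂ → ℂ}
    (h : ∀ᵐ θ : ℝ, ∃ a, Tendsto (fun r : ℝ => F (circleMap 0 r θ)) (𝓝[<] 1) (𝓝 a)) :
    ∃ g, IsBoundaryFunction F g := by
  refine ⟨fun ζ => limUnder (𝓝[<] 1) fun r : ℝ => F (r * ζ), ?_⟩
  filter_upwards [h] with θ hθ
  have e : ∀ r : ℝ, (r : ℂ) * circleMap 0 1 θ = circleMap 0 r θ := fun r => by simp [circleMap]
  simp only [e]
  exact tendsto_nhds_limUnder hθ

lemma smul_mem_disc {ρ : ℝ} (h0 : 0 ≤ ρ) (h1 : ρ < 1) {z : ℂ} (hz : ‖z‖ ≤ 1) :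
    (ρ : ℂ) * z ∈ disc := by
  simp only [disc, mem_ball_zero_iff, norm_mul, Complex.norm_real, Real.norm_eq_abs,
    abs_of_nonneg h0]
  nlinarith [norm_nonneg z]

lemma mul_circleMap (ρ r θ : ℝ) : (ρ : ℂ) * circleMap 0 r θ = circleMap 0 (ρ * r) θ := by
  simp [circleMap]; ring

lemma differentiableOn_dilate {F : ℂ → ℂ} (hF : DifferentiableOn ℂ F disc) {ρ : ℝ} (h0 : 0 ≤ ρ)
    (h1 : ρ < 1) : DifferentiableOn ℂ (fun z => F (ρ * z)) (Metric.closedBall 0 1) :=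
  hF.comp (by fun_prop) fun z hz => smul_mem_disc h0 h1 (by simpa using hz)

lemma diffContOnCl_dilate {F : ℂ → ℂ} (hF : DifferentiableOn ℂ F disc) {ρ : ℝ} (h0 : 0 ≤ ρ)
    (h1 : ρ < 1) : DiffContOnCl ℂ (fun z => F (ρ * z)) (Metric.ball 0 1) := by
  apply DifferentiableOn.diffContOnCl
  rw [closure_ball _ one_ne_zero]
  exact differentiableOn_dilate hF h0 h1

/-- A sequence of radii increasing to `1`. -/
noncomputable def radius (n : ℕ) : ℝ := 1 - 1 / ((n : ℝ) + 1)

lemma radius_nonneg (n : ℕ) : 0 ≤ radius n := by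
  have : 1 / ((n : ℝ) + 1) ≤ 1 := by
    rw [div_le_one (by positivity)]; linarith [(Nat.cast_nonneg n : (0 : ℝ) ≤ n)]
  simp only [radius]; linarith

lemma radius_lt_one (n : ℕ) : radius n < 1 := by
  have : 0 < 1 / ((n : ℝ) + 1) := by positivity
  simp only [radius]; linarith

lemma tendsto_radius : Tendsto radius atTop (𝓝 1) := by
  unfold radius
  simpa using (tendsto_one_div_add_atTop_nhds_zero_nat (𝕜 := ℝ)).const_sub 1

lemma tendsto_radius_mul {F : ℂ → ℂ} (hF : DifferentiableOn ℂ F disc) {z : ℂ} (hz : z ∈ disc) :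
    Tendsto (fun n => F (radius n * z)) atTop (𝓝 (F z)) := by
  have hc : ContinuousAt F z := hF.continuousOn.continuousAt (Metric.isOpen_ball.mem_nhds hz)
  refine hc.tendsto.comp ?_
  have := ((Complex.continuous_ofReal.tendsto 1).comp tendsto_radius).mul_const z
  simpa using this

/-- Bounded analytic functions on the disc are angular derivatives of Poisson integrals of
Lipschitz functions. -/
lemma exists_lipschitz_polarPoissonDeriv_eq {F : ℂ → ℂ} (hF : DifferentiableOn ℂ F disc)
    {M : NNReal} (hM : ∀ z ∈ disc, ‖F z‖ ≤ M) :
    ∃ a : ℝ → ℂ, LipschitzWith M a ∧ ∀ θ r : ℝ, 0 ≤ r → r < 1 →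
      Complex.I * circleMap 0 r θ * F (circleMap 0 r θ) =
        (2 * π)⁻¹ • ∫ s in (-π)..π, (-polarPoissonDeriv r s) • a (θ + s) := by
  -- An antiderivative of a function bounded by `M` is `M`-Lipschitz on the convex disc, so it has
  -- radial limits everywhere and these depend on the angle in a Lipschitz way.
  obtain ⟨A, hA⟩ := hF.isExactOn_ball
  have hAL : LipschitzOnWith M A disc :=
    (convex_ball (0 : ℂ) 1).lipschitzOnWith_of_nnnorm_hasDerivWithin_le
      (fun z hz => (hA z hz).hasDerivWithinAt) (fun z hz => hM z hz)
  have hcau : ∀ θ, ∃ b, Tendsto (fun n => A (circleMap 0 (radius n) θ)) atTop (𝓝 b) := by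
    intro θ
    apply cauchySeq_tendsto_of_complete
    have h1 : CauchySeq fun n => (M : ℝ) * radius n := (tendsto_radius.const_mul _).cauchySeq
    rw [Metric.cauchySeq_iff] at h1 ⊢
    intro ε hε
    obtain ⟨n₀, hn₀⟩ := h1 ε hε
    refine ⟨n₀, fun m hm n hn => lt_of_le_of_lt ?_ (hn₀ m hm n hn)⟩
    refine (hAL.dist_le_mul _ (circleMap_mem_disc (radius_nonneg m) (radius_lt_one m) θ) _
      (circleMap_mem_disc (radius_nonneg n) (radius_lt_one n) θ)).trans ?_
    have : dist (circleMap 0 (radius m) θ) (circleMap 0 (radius n) θ) = |radius m - radius n| := by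
      simp only [circleMap, zero_add, dist_eq_norm, ← sub_mul, norm_mul,
        Complex.norm_exp_ofReal_mul_I, mul_one, ← Complex.ofReal_sub, Complex.norm_real,
        Real.norm_eq_abs]
    rw [this, Real.dist_eq, ← mul_sub, abs_mul, NNReal.abs_eq]
  choose a ha using hcau
  refine ⟨a, ?_, ?_⟩
  · apply LipschitzWith.of_dist_le_mul
    intro x y
    refine le_of_tendsto ((ha x).dist (ha y)) (Eventually.of_forall fun n => ?_)
    refine (hAL.dist_le_mul _ (circleMap_mem_disc (radius_nonneg n) (radius_lt_one n) x) _
      (circleMap_mem_disc (radius_nonneg n) (radius_lt_one n) y)).trans ?_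
    have h := (lipschitzWith_circleMap 0 (radius n)).dist_le_mul x y
    have h' : dist (circleMap 0 (radius n) x) (circleMap 0 (radius n) y) ≤ dist x y := by
      refine h.trans ?_
      have : ((Real.nnabs (radius n) : NNReal) : ℝ) ≤ 1 := by
        simp [abs_of_nonneg (radius_nonneg n), (radius_lt_one n).le]
      nlinarith [dist_nonneg (x := x) (y := y)]
    gcongr
  · intro θ r h0 h1
    have hz := circleMap_mem_disc h0 h1 θ
    -- `B` is the angular derivative of `A`. The Poisson formula for dilates of `B` is integrated by
    -- parts, without boundary terms by periodicity of `A` on circles, and then the dilation factor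
    -- tends to `1`.
    set B : ℂ → ℂ := fun z => Complex.I * z * F z with hB
    have hBd : DifferentiableOn ℂ B disc := by
      simp only [hB]; fun_prop
    have heq : ∀ n, B (radius n * circleMap 0 r θ) =
        (2 * π)⁻¹ • ∫ s in (-π)..π,
          (-polarPoissonDeriv r s) • A (circleMap 0 (radius n) (θ + s)) := by
      intro n
      have h := (diffContOnCl_dilate hBd (radius_nonneg n)
        (radius_lt_one n)).circleAverage_poissonKernel_smul hz
      have h' := circleAverage_poissonKernel_smul_eq (fun z => B (radius n * z)) r θ
      rw [← h]
      refine h'.trans ?_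
      congr 1
      have hmem : ∀ s, circleMap 0 (radius n) (θ + s) ∈ disc :=
        fun s => circleMap_mem_disc (radius_nonneg n) (radius_lt_one n) _
      have hder : ∀ s : ℝ, HasDerivAt (fun s : ℝ => A (circleMap 0 (radius n) (θ + s)))
          (B (radius n * circleMap 0 1 (θ + s))) s := by
        intro s
        have h2 := ((hasDerivAt_circleMap 0 (radius n) (θ + s)).comp_const_add θ s)
        have h3 := (hA _ (hmem s)).comp s h2
        convert! h3 using 1
        rw [mul_circleMap, mul_one]
        simp only [hB]; ring
      have hcB : Continuous fun s : ℝ => B (radius n * circleMap 0 1 (θ + s)) := by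
        refine hBd.continuousOn.comp_continuous (by fun_prop) fun s => ?_
        rw [mul_circleMap, mul_one]; exact hmem s
      have hp := intervalIntegral.integral_smul_deriv_eq_deriv_smul
        (a := -π) (b := π) (u := polarPoisson r) (u' := polarPoissonDeriv r)
        (v := fun s : ℝ => A (circleMap 0 (radius n) (θ + s)))
        (v' := fun s : ℝ => B (radius n * circleMap 0 1 (θ + s)))
        (fun s _ => hasDerivAt_polarPoisson h0 h1 s) (fun s _ => hder s)
        ((continuous_polarPoissonDeriv h0 h1).intervalIntegrable _ _)
        (hcB.intervalIntegrable _ _)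
      have hper : A (circleMap 0 (radius n) (θ + π)) = A (circleMap 0 (radius n) (θ + -π)) := by
        rw [← periodic_circleMap 0 (radius n) (θ + -π)]
        congr 2; ring
      rw [hp, polarPoisson_neg, hper, sub_self, zero_sub]
      simp only [neg_smul, intervalIntegral.integral_neg]
    refine tendsto_nhds_unique (tendsto_radius_mul hBd hz) ?_
    simp only [heq]
    apply Tendsto.const_smul
    refine intervalIntegral.tendsto_integral_filter_of_dominated_convergence
      (fun s => |polarPoissonDeriv r s| * (‖A 0‖ + M)) ?_ ?_ ?_ ?_
    · refine Eventually.of_forall fun n => Continuous.aestronglyMeasurable ?_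
      refine (continuous_polarPoissonDeriv h0 h1).neg.smul ?_
      exact hAL.continuousOn.comp_continuous (by fun_prop)
        fun s => circleMap_mem_disc (radius_nonneg n) (radius_lt_one n) _
    · refine Eventually.of_forall fun n => ae_of_all _ fun s _ => ?_
      rw [norm_smul, norm_neg, Real.norm_eq_abs]
      gcongr
      have hm := circleMap_mem_disc (radius_nonneg n) (radius_lt_one n) (θ + s)
      have := hAL.dist_le_mul _ hm 0 (by simp [disc])
      have h2 : dist (circleMap 0 (radius n) (θ + s)) 0 ≤ 1 := (Metric.mem_ball.1 hm).le
      have h3 : dist (A (circleMap 0 (radius n) (θ + s))) (A 0) ≤ M := by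
        nlinarith [M.2, dist_nonneg (x := circleMap 0 (radius n) (θ + s)) (y := (0 : ℂ))]
      rw [dist_eq_norm] at h3
      have := norm_le_norm_add_norm_sub' (A (circleMap 0 (radius n) (θ + s))) (A 0)
      linarith
    · exact ((continuous_polarPoissonDeriv h0 h1).abs.mul continuous_const).intervalIntegrable _ _
    · exact ae_of_all _ fun s _ => (ha (θ + s)).const_smul _

/-- Bounded analytic functions on the disc have radial limits almost everywhere. -/
theorem exists_isBoundaryFunction_of_bounded {F : ℂ → ℂ} (hF : DifferentiableOn ℂ F disc)
    {M : NNReal} (hM : ∀ z ∈ disc, ‖F z‖ ≤ M) : ∃ g, IsBoundaryFunction F g := by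
  obtain ⟨a, haL, ha⟩ := exists_lipschitz_polarPoissonDeriv_eq hF hM
  apply exists_isBoundaryFunction
  filter_upwards [haL.ae_differentiableAt_real] with θ hθ
  -- A Lipschitz function is differentiable almost everywhere, and where it is, its derivative is
  -- the radial limit of `i z F(z)`; dividing by `i z` recovers that of `F`.
  refine ⟨(Complex.I * circleMap 0 1 θ)⁻¹ * deriv a θ, ?_⟩
  have hlim := tendsto_integral_polarPoissonDeriv haL.continuous hθ.hasDerivAt
  have hinv : Tendsto (fun r : ℝ => (Complex.I * circleMap 0 r θ)⁻¹) (𝓝[<] 1)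
      (𝓝 (Complex.I * circleMap 0 1 θ)⁻¹) := by
    apply Tendsto.inv₀ _ (by simp)
    have : Continuous fun r : ℝ => Complex.I * circleMap 0 r θ := by
      simp only [circleMap]; fun_prop
    exact (this.tendsto 1).mono_left nhdsWithin_le_nhds
  refine (hinv.mul hlim).congr' ?_
  filter_upwards [(Ioo_mem_nhdsLT (by norm_num) : Set.Ioo (1 / 2 : ℝ) 1 ∈ 𝓝[<] 1)] with r hr
  have h0 : 0 < r := by linarith [hr.1]
  rw [← ha θ r h0.le hr.2, ← mul_assoc, inv_mul_cancel₀, one_mul]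
  simp [h0.ne']

/-! ### Fatou's lemma and Schwarz integrals on the circle. -/

lemma ae_circleMap_of_ae_restrict {p : ℂ → Prop}
    (h : ∀ᵐ θ : ℝ ∂volume.restrict (Set.Ioc 0 (2 * π)), p (circleMap 0 1 θ)) :
    ∀ᵐ θ : ℝ, p (circleMap 0 1 θ) := by
  rw [ae_restrict_iff' measurableSet_Ioc] at h
  have h2 : ∀ᵐ θ : ℝ, ∀ k : ℤ, θ + k * (2 * π) ∈ Set.Ioc 0 (2 * π) →
      p (circleMap 0 1 (θ + k * (2 * π))) := by
    rw [ae_all_iff]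
    exact fun k => (measurePreserving_add_right volume ((k : ℝ) * (2 * π))
      ).quasiMeasurePreserving.ae h
  filter_upwards [h2] with θ hθ
  obtain ⟨k, hk, -⟩ := existsUnique_add_zsmul_mem_Ioc two_pi_pos θ 0
  rw [zero_add, zsmul_eq_mul] at hk
  have := hθ k hk
  rwa [(periodic_circleMap 0 1).int_mul k θ] at this

/-- Fatou's lemma for a convergent sequence of nonnegative integrable functions. -/
lemma integrable_and_integral_le_of_tendsto {α : Type*} [MeasurableSpace α] {μ : Measure α}
    {k : ℕ → α → ℝ} {k' : α → ℝ} {c : ℝ} (hk : ∀ n, Integrable (k n) μ)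
    (h0 : ∀ n, ∀ᵐ x ∂μ, 0 ≤ k n x) (hlim : ∀ᵐ x ∂μ, Tendsto (fun n => k n x) atTop (𝓝 (k' x)))
    (hc : Tendsto (fun n => ∫ x, k n x ∂μ) atTop (𝓝 c)) :
    Integrable k' μ ∧ ∫ x, k' x ∂μ ≤ c := by
  have h0' : ∀ᵐ x ∂μ, 0 ≤ k' x := by
    filter_upwards [hlim, ae_all_iff.2 h0] with x hx hx0
    exact ge_of_tendsto' hx hx0
  have hm : AEStronglyMeasurable k' μ :=
    aestronglyMeasurable_of_tendsto_ae atTop (fun n => (hk n).aestronglyMeasurable) hlim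
  have hc0 : 0 ≤ c := ge_of_tendsto' hc fun n => integral_nonneg_of_ae (h0 n)
  have hF : ∫⁻ x, ENNReal.ofReal (k' x) ∂μ ≤ ENNReal.ofReal c := by
    calc ∫⁻ x, ENNReal.ofReal (k' x) ∂μ
        = ∫⁻ x, liminf (fun n => ENNReal.ofReal (k n x)) atTop ∂μ := by
          apply lintegral_congr_ae
          filter_upwards [hlim] with x hx
          exact ((ENNReal.continuous_ofReal.tendsto _).comp hx).liminf_eq.symm
      _ ≤ liminf (fun n => ∫⁻ x, ENNReal.ofReal (k n x) ∂μ) atTop :=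
          lintegral_liminf_le' fun n => (hk n).aestronglyMeasurable.aemeasurable.ennreal_ofReal
      _ = ENNReal.ofReal c := by
          simp_rw [← fun n => ofReal_integral_eq_lintegral_ofReal (hk n) (h0 n)]
          exact ((ENNReal.continuous_ofReal.tendsto _).comp hc).liminf_eq
  have hi : Integrable k' μ := by
    refine ⟨hm, ?_⟩
    rw [hasFiniteIntegral_iff_ofReal h0']
    exact hF.trans_lt ENNReal.ofReal_lt_top
  refine ⟨hi, ?_⟩
  rw [← ofReal_integral_eq_lintegral_ofReal hi h0'] at hF
  exact (ENNReal.ofReal_le_ofReal_iff hc0).1 hF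

/-- The Schwarz integral of a real function on the unit circle. -/
noncomputable def schwarz (ψ : ℂ → ℝ) (z : ℂ) : ℂ :=
  circleAverage (fun ζ => (ζ + z) / (ζ - z) * (ψ ζ : ℂ)) 0 1

/-- The Fourier coefficients of nonnegative index of a real function on the unit circle. -/
noncomputable def circleCoeff (ψ : ℂ → ℝ) (n : ℕ) : ℂ :=
  circleAverage (fun ζ => (ζ ^ n)⁻¹ * (ψ ζ : ℂ)) 0 1

lemma schwarz_eq_herglotz (ψ : ℂ → ℝ) (z : ℂ) :
    schwarz ψ z = circleAverage (fun ζ => herglotzRieszKernel 0 z ζ • (ψ ζ : ℂ)) 0 1 := by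
  simp [schwarz, herglotzRieszKernel]

lemma circleIntegrable_ofReal {ψ : ℂ → ℝ} (hψ : CircleIntegrable ψ 0 1) :
    CircleIntegrable (fun ζ => (ψ ζ : ℂ)) 0 1 := by
  simp only [CircleIntegrable, intervalIntegrable_iff] at hψ ⊢
  exact Complex.ofRealCLM.integrable_comp hψ

lemma circleIntegrable_schwarz {ψ : ℂ → ℝ} (hψ : CircleIntegrable ψ 0 1) {z : ℂ} (hz : z ∈ disc) :
    CircleIntegrable (fun ζ => (ζ + z) / (ζ - z) * (ψ ζ : ℂ)) 0 1 := by
  have := (circleIntegrable_ofReal hψ).continuousOn_smul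
    (continuousOn_herglotzRieszKernel_sphere hz)
  refine this.congr fun θ _ => ?_
  simp [herglotzRieszKernel]

lemma differentiableOn_schwarz {ψ : ℂ → ℝ} (hψ : CircleIntegrable ψ 0 1) :
    DifferentiableOn ℂ (schwarz ψ) disc :=
  (differentiableOn_circleAverage_herglotzRieszKernel_smul (circleIntegrable_ofReal hψ)).congr
    fun z _ => schwarz_eq_herglotz ψ z

lemma re_schwarz {ψ : ℂ → ℝ} (hψ : CircleIntegrable ψ 0 1) {z : ℂ} (hz : z ∈ disc) :
    (schwarz ψ z).re = circleAverage (fun ζ => poissonKernel 0 z ζ * ψ ζ) 0 1 := by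
  rw [schwarz_eq_herglotz, re_circleAverage_herglotzRieszKernel_smul hψ hz,
    ← poissonKernel_eq_re_herglotzRieszKernel]
  rfl

lemma schwarz_sub {ψ₁ ψ₂ : ℂ → ℝ} (h₁ : CircleIntegrable ψ₁ 0 1) (h₂ : CircleIntegrable ψ₂ 0 1)
    {z : ℂ} (hz : z ∈ disc) :
    schwarz (fun ζ => ψ₁ ζ - ψ₂ ζ) z = schwarz ψ₁ z - schwarz ψ₂ z := by
  rw [schwarz, schwarz, schwarz, ← circleAverage_fun_sub (circleIntegrable_schwarz h₁ hz)
    (circleIntegrable_schwarz h₂ hz)]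
  congr 1; ext ζ; push_cast; ring

lemma circleAverage_congr_ae {E : Type*} [NormedAddCommGroup E] [NormedSpace ℝ E] {k l : ℂ → E}
    (h : ∀ᵐ θ : ℝ, k (circleMap 0 1 θ) = l (circleMap 0 1 θ)) :
    circleAverage k 0 1 = circleAverage l 0 1 := by
  rw [circleAverage_def, circleAverage_def]
  congr 1
  exact intervalIntegral.integral_congr_ae (h.mono fun θ hθ _ => hθ)

lemma ae_tendsto_re_schwarz {ψ : ℂ → ℝ} (hψ : CircleIntegrable ψ 0 1) :
    ∀ᵐ θ : ℝ, Tendsto (fun r : ℝ => (schwarz ψ (circleMap 0 r θ)).re)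
      (𝓝[<] 1) (𝓝 (ψ (circleMap 0 1 θ))) := by
  filter_upwards [ae_tendsto_circleAverage_poissonKernel hψ] with θ hθ
  refine hθ.congr' ?_
  filter_upwards [(Ioo_mem_nhdsLT (by norm_num) : Set.Ioo (0 : ℝ) 1 ∈ 𝓝[<] 1)] with r hr
  rw [re_schwarz hψ (circleMap_mem_disc hr.1.le hr.2 θ)]

lemma norm_circleCoeff_le (ψ : ℂ → ℝ) (n : ℕ) :
    ‖circleCoeff ψ n‖ ≤ circleAverage (fun ζ => |ψ ζ|) 0 1 := by
  rw [circleCoeff, circleAverage_def, circleAverage_def, norm_smul, smul_eq_mul,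
    Real.norm_of_nonneg (by positivity)]
  gcongr
  refine (intervalIntegral.norm_integral_le_integral_norm two_pi_pos.le).trans (le_of_eq ?_)
  congr 1; ext θ
  simp

/-- Termwise integration of `(ζ + z) / (ζ - z) = 1 + 2 ∑_{n ≥ 1} (z / ζ)^n`. The index starts at `1`
because the constant term is not doubled. -/
lemma hasSum_schwarz {ψ : ℂ → ℝ} (hψ : CircleIntegrable ψ 0 1) {z : ℂ} (hz : z ∈ disc) :
    HasSum (fun n => 2 * circleCoeff ψ (n + 1) * z ^ (n + 1)) (schwarz ψ z - circleCoeff ψ 0) := by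
  have hz1 : ‖z‖ < 1 := by simpa using hz
  have key : HasSum (fun n : ℕ => ∫ θ in (0 : ℝ)..2 * π,
      2 * (z / circleMap 0 1 θ) ^ (n + 1) * (ψ (circleMap 0 1 θ) : ℂ))
      (∫ θ in (0 : ℝ)..2 * π, ((circleMap 0 1 θ + z) / (circleMap 0 1 θ - z) - 1) *
        (ψ (circleMap 0 1 θ) : ℂ)) := by
    have hm := IntervalIntegrable.aestronglyMeasurable_restrict_uIoc (circleIntegrable_ofReal hψ)
    refine intervalIntegral.hasSum_integral_of_dominated_convergence
      (fun n θ => 2 * ‖z‖ ^ (n + 1) * |ψ (circleMap 0 1 θ)|) (fun n => ?_) (fun n => ?_) ?_ ?_ ?_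
    · refine AEStronglyMeasurable.mul (Continuous.aestronglyMeasurable ?_) hm
      refine continuous_const.mul (Continuous.pow (continuous_const.div (by fun_prop) ?_) _)
      intro θ; simp
    · exact ae_of_all _ fun θ _ => by simp
    · refine ae_of_all _ fun θ _ => Summable.mul_right _ (Summable.mul_left _ ?_)
      exact (summable_nat_add_iff 1).2 (summable_geometric_of_lt_one (norm_nonneg z) hz1)
    · simp only [tsum_mul_right]
      exact IntervalIntegrable.const_mul (CircleIntegrable.abs hψ) _
    · refine ae_of_all _ fun θ _ => HasSum.mul_right _ ?_
      set ζ := circleMap 0 1 θ with hζ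
      have hζ1 : ‖ζ‖ = 1 := by simp [hζ]
      have hζ0 : ζ ≠ 0 := by simp [hζ]
      have hne : ζ - z ≠ 0 := sub_ne_zero.2 fun h => by rw [h] at hζ1; linarith
      have h1 : ‖z / ζ‖ < 1 := by rw [norm_div, hζ1, div_one]; exact hz1
      have := ((hasSum_geometric_of_norm_lt_one h1).mul_left (2 * (z / ζ)))
      have h2 : 1 - z / ζ ≠ 0 := by
        intro h
        apply hne
        field_simp at h
        simpa using h
      convert! this using 1
      · ext n; ring
      · field_simp; ring
  have hS : schwarz ψ z - circleCoeff ψ 0 = (2 * π)⁻¹ • ∫ θ in (0 : ℝ)..2 * π,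
      ((circleMap 0 1 θ + z) / (circleMap 0 1 θ - z) - 1) * (ψ (circleMap 0 1 θ) : ℂ) := by
    rw [schwarz, circleCoeff, ← circleAverage_fun_sub (circleIntegrable_schwarz hψ hz)
      (by simpa using circleIntegrable_ofReal hψ), circleAverage_def]
    congr 2; ext θ; simp; ring
  rw [hS]
  convert! key.const_smul ((2 * π)⁻¹ : ℝ) using 1
  ext n
  rw [circleCoeff, circleAverage_def]
  simp only [Complex.real_smul]
  rw [← mul_assoc, mul_comm (2 : ℂ), mul_assoc, mul_assoc,
    ← intervalIntegral.integral_mul_const, ← intervalIntegral.integral_const_mul]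
  congr 2; ext θ
  rw [div_pow]; ring

lemma tendsto_radius_nhdsLT : Tendsto radius atTop (𝓝[<] 1) :=
  tendsto_nhdsWithin_iff.2 ⟨tendsto_radius, Eventually.of_forall radius_lt_one⟩

lemma continuousOn_dilate_sphere {F : ℂ → ℂ} (hF : DifferentiableOn ℂ F disc) {ρ : ℝ} (h0 : 0 ≤ ρ)
    (h1 : ρ < 1) : ContinuousOn (fun z => F (ρ * z)) (Metric.sphere 0 1) :=
  (differentiableOn_dilate hF h0 h1).continuousOn.mono Metric.sphere_subset_closedBall

lemma continuousOn_poissonKernel {z : ℂ} (hz : z ∈ disc) :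
    ContinuousOn (poissonKernel 0 z) (Metric.sphere 0 1) := by
  rw [poissonKernel_eq_re_herglotzRieszKernel]
  have := continuousOn_herglotzRieszKernel_sphere hz
  rw [abs_one] at this
  exact Complex.continuous_re.comp_continuousOn this

lemma poissonKernel_nonneg {z ζ : ℂ} (hz : z ∈ disc) (hζ : ‖ζ‖ = 1) : 0 ≤ poissonKernel 0 z ζ := by
  have hz1 : ‖z‖ < 1 := by simpa using hz
  rw [poissonKernel, sub_zero, sub_zero, hζ]
  apply div_nonneg _ (sq_nonneg _)
  nlinarith [norm_nonneg z]

lemma poissonKernel_le {z ζ : ℂ} (hz : z ∈ disc) (hζ : ‖ζ‖ = 1) :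
    poissonKernel 0 z ζ ≤ (1 + ‖z‖) / (1 - ‖z‖) := by
  have := re_herglotzRieszKernel_le (c := 0) (R := 1) (z := ζ) (by simpa using hζ) hz
  rw [poissonKernel_eq_re_herglotzRieszKernel]
  simpa [herglotzRieszKernel] using this

/-- Dilating first makes the function continuous up to the circle, where the Poisson formula is
exact; the boundary theorems below follow by letting the dilation factor tend to `1`. -/
lemma circleAverage_poissonKernel_mul_re {H : ℂ → ℂ} (hH : DifferentiableOn ℂ H disc) {ρ : ℝ}
    (h0 : 0 ≤ ρ) (h1 : ρ < 1) {z : ℂ} (hz : z ∈ disc) :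
    circleAverage (fun ζ => poissonKernel 0 z ζ * (H (ρ * ζ)).re) 0 1 = (H (ρ * z)).re := by
  have h := (diffContOnCl_dilate hH h0 h1).circleAverage_poissonKernel_smul hz
  have hi : CircleIntegrable (poissonKernel 0 z • fun ζ => H (ρ * ζ)) 0 1 := by
    apply ContinuousOn.circleIntegrable zero_le_one
    exact (continuousOn_poissonKernel hz).smul (continuousOn_dilate_sphere hH h0 h1)
  have h2 := Complex.reCLM.circleAverage_comp_comm hi
  rw [h] at h2
  rw [← Complex.reCLM_apply, ← h2]
  congr 1; ext ζ
  simp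

lemma circleAverage_eq_setIntegral (k : ℂ → ℝ) :
    circleAverage k 0 1 = (2 * π)⁻¹ * ∫ θ in Set.Ioc 0 (2 * π), k (circleMap 0 1 θ) := by
  rw [circleAverage_def, intervalIntegral.integral_of_le two_pi_pos.le, smul_eq_mul]

lemma circleIntegrable_iff_integrable {k : ℂ → ℝ} :
    CircleIntegrable k 0 1 ↔
      Integrable (fun θ => k (circleMap 0 1 θ)) (volume.restrict (Set.Ioc 0 (2 * π))) := by
  rw [CircleIntegrable, intervalIntegrable_iff_integrableOn_Ioc_of_le two_pi_pos.le]
  rfl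

/-- Fatou's lemma for circle averages. -/
lemma circleIntegrable_and_circleAverage_le_of_tendsto {k : ℕ → ℂ → ℝ} {k' : ℂ → ℝ} {c : ℝ}
    (hk : ∀ n, CircleIntegrable (k n) 0 1) (h0 : ∀ n ζ, ‖ζ‖ = 1 → 0 ≤ k n ζ)
    (hlim : ∀ᵐ θ : ℝ, Tendsto (fun n => k n (circleMap 0 1 θ)) atTop (𝓝 (k' (circleMap 0 1 θ))))
    (hc : Tendsto (fun n => circleAverage (k n) 0 1) atTop (𝓝 c)) :
    CircleIntegrable k' 0 1 ∧ circleAverage k' 0 1 ≤ c := by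
  rw [circleIntegrable_iff_integrable, circleAverage_eq_setIntegral]
  have hpi := two_pi_pos
  have h := integrable_and_integral_le_of_tendsto (c := 2 * π * c)
    (fun n => circleIntegrable_iff_integrable.1 (hk n))
    (fun n => ae_of_all _ fun θ => h0 n _ (by simp)) (ae_restrict_of_ae hlim) (by
      have := hc.const_mul (2 * π)
      refine this.congr fun n => ?_
      rw [circleAverage_eq_setIntegral]
      field_simp)
  refine ⟨h.1, ?_⟩
  rw [inv_mul_le_iff₀ hpi]
  exact h.2

/-! ### Positive harmonic functions and harmonic majorants. -/

/-- Analytic functions with nonnegative real part: the radial limits of the real part exist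
almost everywhere, and its Poisson integral is a minorant. -/
theorem exists_boundary_re {H : ℂ → ℂ} (hH : DifferentiableOn ℂ H disc)
    (h0 : ∀ z ∈ disc, 0 ≤ (H z).re) :
    ∃ ψ : ℂ → ℝ, CircleIntegrable ψ 0 1 ∧
      (∀ᵐ θ : ℝ, Tendsto (fun r : ℝ => (H (circleMap 0 r θ)).re) (𝓝[<] 1)
        (𝓝 (ψ (circleMap 0 1 θ)))) ∧
      ∀ z ∈ disc, (schwarz ψ z).re ≤ (H z).re := by
  -- `exp (-H)` is bounded by `1`, so it has radial limits `g`, and `Re H` tends to `-log |g|`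
  -- wherever `g ≠ 0`.
  obtain ⟨g, hg⟩ := exists_isBoundaryFunction_of_bounded (F := fun z => Complex.exp (-H z))
    (hH.neg.cexp) (M := 1) (fun z hz => by
      rw [Complex.norm_exp]; simpa using h0 z hz)
  have hzero : (0 : ℂ) ∈ disc := by simp [disc]
  have hcont : ∀ n, ContinuousOn (fun ζ => (H (radius n * ζ)).re) (Metric.sphere 0 1) := fun n =>
    Complex.continuous_re.comp_continuousOn
      (continuousOn_dilate_sphere hH (radius_nonneg n) (radius_lt_one n))
  have hnn : ∀ n ζ, ‖ζ‖ = 1 → 0 ≤ (H (radius n * ζ)).re := fun n ζ hζ =>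
    h0 _ (smul_mem_disc (radius_nonneg n) (radius_lt_one n) hζ.le)
  have hmean : ∀ n, circleAverage (fun ζ => (H (radius n * ζ)).re) 0 1 = (H 0).re := fun n => by
    have := circleAverage_poissonKernel_mul_re hH (radius_nonneg n) (radius_lt_one n) hzero
    rw [mul_zero] at this
    rw [← this]
    apply circleAverage_congr_sphere
    intro ζ hζ
    have : ‖ζ‖ = 1 := by simpa using hζ
    simp [poissonKernel, this]
  -- The circular means of `Re H` all equal `Re H(0)`. By Fatou's lemma the radial lower limit is
  -- finite almost everywhere, which rules out `g = 0`, where `Re H` would tend to infinity.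
  have hliminf : ∀ᵐ θ : ℝ ∂volume.restrict (Set.Ioc 0 (2 * π)),
      liminf (fun n => ENNReal.ofReal (H (radius n * circleMap 0 1 θ)).re) atTop < ⊤ := by
    have hi : ∀ n, Integrable (fun θ => (H (radius n * circleMap 0 1 θ)).re)
        (volume.restrict (Set.Ioc 0 (2 * π))) := fun n =>
      circleIntegrable_iff_integrable.1 ((hcont n).circleIntegrable zero_le_one)
    apply ae_lt_top
    · exact Measurable.liminf fun n => ((hcont n).comp_continuous (continuous_circleMap 0 1)
        fun θ => by simp).measurable.ennreal_ofReal
    · refine ne_top_of_le_ne_top (b := ENNReal.ofReal (2 * π * (H 0).re)) ENNReal.ofReal_ne_top ?_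
      refine (lintegral_liminf_le'
        fun n => (hi n).aestronglyMeasurable.aemeasurable.ennreal_ofReal).trans ?_
      have : ∀ n, ∫⁻ θ in Set.Ioc 0 (2 * π), ENNReal.ofReal (H (radius n * circleMap 0 1 θ)).re =
          ENNReal.ofReal (2 * π * (H 0).re) := fun n => by
        rw [← ofReal_integral_eq_lintegral_ofReal (hi n)
          (ae_of_all _ fun θ => hnn n _ (by simp)), ← hmean n, circleAverage_eq_setIntegral]
        congr 1
        have := pi_pos
        field_simp
      simp [this]
  have hliminf' := ae_circleMap_of_ae_restrict
    (p := fun ζ => liminf (fun n => ENNReal.ofReal (H (radius n * ζ)).re) atTop < ⊤) hliminf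
  have hlim : ∀ᵐ θ : ℝ, Tendsto (fun r : ℝ => (H (circleMap 0 r θ)).re) (𝓝[<] 1)
      (𝓝 (-Real.log ‖g (circleMap 0 1 θ)‖)) := by
    filter_upwards [hg, hliminf'] with θ hθ hfin
    have hn : Tendsto (fun r : ℝ => Real.exp (-(H (circleMap 0 r θ)).re)) (𝓝[<] 1)
        (𝓝 ‖g (circleMap 0 1 θ)‖) := by
      refine hθ.norm.congr fun r => ?_
      rw [Complex.norm_exp, Complex.neg_re]
    have hne : ‖g (circleMap 0 1 θ)‖ ≠ 0 := by
      intro h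
      rw [h] at hn
      have h1 := Real.tendsto_exp_comp_nhds_zero.1 hn
      have h2 := (tendsto_neg_atBot_atTop.comp h1).comp tendsto_radius_nhdsLT
      have h3 := ENNReal.tendsto_ofReal_atTop.comp h2
      have h4 := h3.liminf_eq
      refine hfin.ne ?_
      rw [← h4]
      congr 1; ext n
      simp [mul_circleMap]
    have := (hn.log hne).neg
    simpa using this
  have hlim' : ∀ᵐ θ : ℝ, Tendsto (fun n => (H (radius n * circleMap 0 1 θ)).re) atTop
      (𝓝 (-Real.log ‖g (circleMap 0 1 θ)‖)) := by
    filter_upwards [hlim] with θ hθ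
    refine (hθ.comp tendsto_radius_nhdsLT).congr fun n => ?_
    simp [mul_circleMap]
  have hψ : CircleIntegrable (fun ζ => -Real.log ‖g ζ‖) 0 1 :=
    (circleIntegrable_and_circleAverage_le_of_tendsto (c := (H 0).re)
      (fun n => (hcont n).circleIntegrable zero_le_one) hnn hlim' (by simp [hmean])).1
  refine ⟨fun ζ => -Real.log ‖g ζ‖, hψ, hlim, fun z hz => ?_⟩
  rw [re_schwarz hψ hz]
  -- Fatou's lemma again, weighted by the Poisson kernel. Only an inequality survives: the missing
  -- mass is the singular part.
  refine (circleIntegrable_and_circleAverage_le_of_tendsto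
    (k := fun n ζ => poissonKernel 0 z ζ * (H (radius n * ζ)).re)
    (fun n => ((continuousOn_poissonKernel hz).mul (hcont n)).circleIntegrable zero_le_one)
    (fun n ζ hζ => mul_nonneg (poissonKernel_nonneg hz hζ) (hnn n ζ hζ)) ?_ ?_).2
  · filter_upwards [hlim'] with θ hθ
    exact hθ.const_mul _
  · simp only [circleAverage_poissonKernel_mul_re hH (radius_nonneg _) (radius_lt_one _) hz]
    exact (Complex.continuous_re.tendsto _).comp (tendsto_radius_mul hH hz)

/-- Subharmonicity of the positive part of the real part of an analytic function. -/
lemma max_re_le_circleAverage {h : ℂ → ℂ} (hh : DifferentiableOn ℂ h disc) {ρ : ℝ}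
    (h0 : 0 ≤ ρ) (h1 : ρ < 1) {z : ℂ} (hz : z ∈ disc) :
    max (h (ρ * z)).re 0 ≤
      circleAverage (fun ζ => poissonKernel 0 z ζ * max (h (ρ * ζ)).re 0) 0 1 := by
  have hc : ContinuousOn (fun ζ => (h (ρ * ζ)).re) (Metric.sphere 0 1) :=
    Complex.continuous_re.comp_continuousOn (continuousOn_dilate_sphere hh h0 h1)
  have hP := continuousOn_poissonKernel hz
  apply max_le
  · rw [← circleAverage_poissonKernel_mul_re hh h0 h1 hz]
    refine circleAverage_mono ((hP.mul hc).circleIntegrable zero_le_one)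
      ((hP.mul (hc.sup continuousOn_const)).circleIntegrable zero_le_one) fun ζ hζ => ?_
    have hζ1 : ‖ζ‖ = 1 := by simpa using hζ
    exact mul_le_mul_of_nonneg_left (le_max_left _ _) (poissonKernel_nonneg hz hζ1)
  · refine circleAverage_nonneg_of_nonneg fun ζ hζ => ?_
    have hζ1 : ‖ζ‖ = 1 := by simpa using hζ
    exact mul_nonneg (poissonKernel_nonneg hz hζ1) (le_max_right _ _)

/-- Analyticity of the power series with bounded coefficients. -/
lemma differentiableOn_tsum_pow {C : ℕ → ℂ} {M : ℝ} (hC : ∀ n, ‖C n‖ ≤ M) :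
    DifferentiableOn ℂ (fun z => ∑' n, 2 * C (n + 1) * z ^ (n + 1)) disc := by
  intro z hz
  have hz1 : ‖z‖ < 1 := by simpa using hz
  obtain ⟨R, hzR, hR1⟩ := exists_between hz1
  have hR0 : 0 ≤ R := (norm_nonneg z).trans hzR.le
  have hd : DifferentiableOn ℂ (fun z => ∑' n, 2 * C (n + 1) * z ^ (n + 1)) (Metric.ball 0 R) := by
    refine Complex.differentiableOn_tsum_of_summable_norm (u := fun n => 2 * M * R ^ (n + 1)) ?_
      (fun n => by fun_prop) Metric.isOpen_ball fun n w hw => ?_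
    · exact Summable.mul_left _ ((summable_nat_add_iff 1).2 (summable_geometric_of_lt_one hR0 hR1))
    · have hw1 : ‖w‖ ≤ R := by simpa using (mem_ball_zero_iff.1 hw).le
      have hM0 : 0 ≤ M := (norm_nonneg _).trans (hC 0)
      rw [norm_mul, norm_mul, norm_pow, Complex.norm_two]
      gcongr
      exact hC _
  exact (hd.differentiableAt (Metric.isOpen_ball.mem_nhds (by simpa using hzR))
    ).differentiableWithinAt

/-- If the means of the positive part of `Re h` are bounded, then `Re h` has a positive harmonic
majorant. -/
theorem exists_majorant {h : ℂ → ℂ} (hh : DifferentiableOn ℂ h disc) {M : ℝ}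
    (hM : ∀ r ∈ Set.Ico (0 : ℝ) 1, circleAverage (fun z => max (h z).re 0) 0 r ≤ M) :
    ∃ H : ℂ → ℂ, DifferentiableOn ℂ H disc ∧ ∀ z ∈ disc, max (h z).re 0 ≤ (H z).re := by
  set ψ : ℕ → ℂ → ℝ := fun k ζ => max (h (radius k * ζ)).re 0 with hψdef
  have hψ : ∀ k, CircleIntegrable (ψ k) 0 1 := fun k => by
    apply ContinuousOn.circleIntegrable zero_le_one
    exact (Complex.continuous_re.comp_continuousOn (continuousOn_dilate_sphere hh
      (radius_nonneg k) (radius_lt_one k))).sup continuousOn_const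
  have hψM : ∀ k n, ‖circleCoeff (ψ k) n‖ ≤ M := fun k n => by
    refine (norm_circleCoeff_le _ _).trans ?_
    refine le_trans (le_of_eq ?_) (hM (radius k) ⟨radius_nonneg k, radius_lt_one k⟩)
    rw [circleAverage_def, circleAverage_def]
    congr 2; ext θ
    simp only [hψdef, mul_circleMap, mul_one]
    exact abs_of_nonneg (le_max_right _ _)
  -- Limits along one fixed ultrafilter exist for all the bounded coefficient sequences at once;
  -- this takes the place of a diagonal subsequence or a weak limit of measures.
  have hex : ∀ n, ∃ c, ‖c‖ ≤ M ∧ Tendsto (fun k => circleCoeff (ψ k) n)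
      (hyperfilter ℕ : Filter ℕ) (𝓝 c) := fun n => by
    have hcomp := isCompact_closedBall (0 : ℂ) M
    obtain ⟨c, hc, hlim⟩ := hcomp.ultrafilter_le_nhds
      ((hyperfilter ℕ).map fun k => circleCoeff (ψ k) n) (by
        rw [le_principal_iff]
        exact Filter.mem_map.2 (Filter.univ_mem' fun k => by simpa using hψM k n))
    exact ⟨c, by simpa using hc, hlim⟩
  choose C hCM hC using hex
  have hle : (hyperfilter ℕ : Filter ℕ) ≤ atTop := Nat.hyperfilter_le_atTop
  refine ⟨fun z => C 0 + ∑' n, 2 * C (n + 1) * z ^ (n + 1),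
    (differentiableOn_const _).add (differentiableOn_tsum_pow hCM), fun z hz => ?_⟩
  have hz1 : ‖z‖ < 1 := by simpa using hz
  have hM0 : 0 ≤ M := (norm_nonneg _).trans (hCM 0)
  have hlim : Tendsto (fun k => schwarz (ψ k) z) (hyperfilter ℕ : Filter ℕ)
      (𝓝 (C 0 + ∑' n, 2 * C (n + 1) * z ^ (n + 1))) := by
    have e : ∀ k, schwarz (ψ k) z =
        circleCoeff (ψ k) 0 + ∑' n, 2 * circleCoeff (ψ k) (n + 1) * z ^ (n + 1) := fun k => by
      rw [(hasSum_schwarz (hψ k) hz).tsum_eq]; ring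
    simp only [e]
    refine (hC 0).add (tendsto_tsum_of_dominated_convergence
      (bound := fun n => 2 * M * ‖z‖ ^ (n + 1)) ?_ (fun n => ?_) ?_)
    · exact Summable.mul_left _
        ((summable_nat_add_iff 1).2 (summable_geometric_of_lt_one (norm_nonneg z) hz1))
    · exact ((hC (n + 1)).const_mul 2).mul_const _
    · refine Eventually.of_forall fun k n => ?_
      rw [norm_mul, norm_mul, norm_pow, Complex.norm_two]
      gcongr
      exact hψM _ _
  -- Subharmonicity on each dilate gives the bound by `Re (schwarz (ψ k) z)`, and both sides
  -- converge along the ultrafilter.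
  refine le_of_tendsto_of_tendsto (b := (hyperfilter ℕ : Filter ℕ))
    (f := fun k => max (h (radius k * z)).re 0) ?_
    ((Complex.continuous_re.tendsto _).comp hlim) (Eventually.of_forall fun k => ?_)
  · exact (((Complex.continuous_re.tendsto _).comp (tendsto_radius_mul hh hz)).max
      tendsto_const_nhds).mono_left hle
  · simp only [Function.comp_apply]
    rw [re_schwarz (hψ k) hz]
    exact max_re_le_circleAverage hh (radius_nonneg k) (radius_lt_one k) hz

/-! ### Rotations, powers and Fourier coefficients. -/

lemma mul_circleMap_eq_circleMap_add {ζ : ℂ} (hζ : ‖ζ‖ = 1) (r θ : ℝ) :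
    ζ * circleMap 0 r θ = circleMap 0 r (θ + ζ.arg) := by
  conv_lhs => rw [← Complex.norm_mul_exp_arg_mul_I ζ, hζ]
  simp only [circleMap, zero_add, Complex.ofReal_add, add_mul, Complex.exp_add,
    Complex.ofReal_one, one_mul]
  ring

lemma circleAverage_comp_mul {E : Type*} [NormedAddCommGroup E] [NormedSpace ℝ E] (k : ℂ → E)
    {ζ : ℂ} (hζ : ‖ζ‖ = 1) : circleAverage (fun η => k (ζ * η)) 0 1 = circleAverage k 0 1 := by
  rw [circleAverage_eq_integral_add (f := k) ζ.arg, circleAverage_def]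
  simp only [mul_circleMap_eq_circleMap_add hζ]

lemma circleMap_pow (r θ : ℝ) (N : ℕ) : circleMap 0 r θ ^ N = circleMap 0 (r ^ N) (N * θ) := by
  simp only [circleMap, zero_add, mul_pow, ← Complex.exp_nat_mul]
  push_cast
  ring_nf

lemma circleAverage_comp_pow {E : Type*} [NormedAddCommGroup E] [NormedSpace ℝ E] {k : ℂ → E}
    (hk : CircleIntegrable k 0 1) {N : ℕ} (hN : N ≠ 0) :
    circleAverage (fun η => k (η ^ N)) 0 1 = circleAverage k 0 1 := by
  rw [circleAverage_def, circleAverage_def]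
  congr 1
  have hN' : (N : ℝ) ≠ 0 := by exact_mod_cast hN
  simp only [circleMap_pow, one_pow]
  rw [intervalIntegral.integral_comp_mul_left (fun θ => k (circleMap 0 1 θ)) hN']
  have h := (periodic_comp_circleMap k).intervalIntegral_add_zsmul_eq N 0
    (intervalIntegrable_comp_circleMap hk)
  simp only [zero_add, mul_zero, natCast_zsmul, nsmul_eq_mul] at h ⊢
  rw [h, ← Nat.cast_smul_eq_nsmul ℝ, smul_smul, inv_mul_cancel₀ hN', one_smul]

/-- The **Riemann–Lebesgue lemma** on the circle. -/
lemma tendsto_circleCoeff (ψ : ℂ → ℝ) : Tendsto (circleCoeff ψ) atTop (𝓝 0) := by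
  have h := Real.tendsto_integral_exp_smul_cocompact
    (Set.indicator (Set.Ioc 0 (2 * π)) fun θ => (ψ (circleMap 0 1 θ) : ℂ))
  -- The additive character on `ℝ` is `exp (2πi x)`, so the frequency `m` on the circle corresponds
  -- to `m / (2π)`.
  have hm : Tendsto (fun m : ℕ => (m : ℝ) / (2 * π)) atTop (cocompact ℝ) :=
    (tendsto_natCast_atTop_atTop.atTop_div_const two_pi_pos).mono_right atTop_le_cocompact
  have h2 := (h.comp hm).const_smul ((2 * π)⁻¹ : ℝ)
  rw [smul_zero] at h2
  refine h2.congr fun m => ?_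
  rw [circleCoeff, circleAverage_def, intervalIntegral.integral_of_le two_pi_pos.le,
    ← integral_indicator measurableSet_Ioc]
  simp only [Function.comp_apply]
  congr 2; ext θ
  by_cases hθ : θ ∈ Set.Ioc 0 (2 * π)
  · simp only [Set.indicator_of_mem hθ]
    rw [Circle.smul_def, Real.fourierChar_apply, smul_eq_mul]
    congr 1
    rw [circleMap_pow, circleMap]
    simp only [one_pow, Complex.ofReal_one, one_mul, zero_add, ← Complex.exp_neg]
    congr 1
    have := pi_pos.ne'
    push_cast
    field_simp
  · simp [Set.indicator_of_notMem hθ]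

lemma norm_of_mem_nthRootsFinset {N : ℕ} (hN : 0 < N) {ζ : ℂ}
    (hζ : ζ ∈ Polynomial.nthRootsFinset N (1 : ℂ)) : ‖ζ‖ = 1 := by
  rw [Polynomial.mem_nthRootsFinset hN] at hζ
  exact Complex.norm_eq_one_of_pow_eq_one hζ hN.ne'

lemma card_nthRootsFinset {N : ℕ} (hN : N ≠ 0) :
    (Polynomial.nthRootsFinset N (1 : ℂ)).card = N :=
  (Complex.isPrimitiveRoot_exp N hN).card_nthRootsFinset

lemma circleIntegrable_comp_mul {E : Type*} [NormedAddCommGroup E] {k : ℂ → E}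
    (hk : CircleIntegrable k 0 1) {ζ : ℂ} (hζ : ‖ζ‖ = 1) :
    CircleIntegrable (fun η => k (ζ * η)) 0 1 := by
  have h := (intervalIntegrable_comp_circleMap hk (0 + ζ.arg) (2 * π + ζ.arg)).comp_add_right ζ.arg
  simp only [add_sub_cancel_right] at h
  simp only [CircleIntegrable, mul_circleMap_eq_circleMap_add hζ]
  exact h

lemma circleIntegrable_pow_inv_mul {ψ : ℂ → ℝ} (hψ : CircleIntegrable ψ 0 1) (m : ℕ) :
    CircleIntegrable (fun η => (η ^ m)⁻¹ * (ψ η : ℂ)) 0 1 := by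
  have hc : ContinuousOn (fun η : ℂ => (η ^ m)⁻¹) (Metric.sphere 0 |1|) := by
    refine ContinuousOn.inv₀ (by fun_prop) fun η hη => pow_ne_zero _ ?_
    rintro rfl; simp at hη
  exact (circleIntegrable_ofReal hψ).continuousOn_mul hc

/-- Integrable functions on the circle invariant under the transfer operator of `ζ ↦ ζ ^ N` have
no nonconstant Fourier modes. -/
theorem circleCoeff_eq_zero {N : ℕ} (hN : 2 ≤ N) {ψ : ℂ → ℝ} (hψ : CircleIntegrable ψ 0 1)
    (h : ∀ᵐ θ : ℝ, (N : ℝ) * ψ (circleMap 0 1 θ ^ N) =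
      ∑ ζ ∈ Polynomial.nthRootsFinset N (1 : ℂ), ψ (ζ * circleMap 0 1 θ)) {n : ℕ} (hn : n ≠ 0) :
    circleCoeff ψ n = 0 := by
  have hN0 : 0 < N := by omega
  -- The mean of `∑ k (ζ η)` is computed twice. Rotation invariance gives `N c(Nm)`. The functional
  -- equation, with `ζ^(Nm) = 1` and invariance of the measure under `η ↦ η^N`, gives `N c(m)`.
  have hstep : ∀ m, circleCoeff ψ (N * m) = circleCoeff ψ m := by
    intro m
    set k : ℂ → ℂ := fun η => (η ^ (N * m))⁻¹ * (ψ η : ℂ) with hk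
    have hki : CircleIntegrable k 0 1 := circleIntegrable_pow_inv_mul hψ _
    have h1 : circleAverage (fun η => ∑ ζ ∈ Polynomial.nthRootsFinset N (1 : ℂ), k (ζ * η)) 0 1 =
        N * circleCoeff ψ (N * m) := by
      rw [circleAverage_fun_sum fun ζ hζ =>
        circleIntegrable_comp_mul hki (norm_of_mem_nthRootsFinset hN0 hζ)]
      rw [Finset.sum_congr rfl fun ζ hζ =>
        circleAverage_comp_mul k (norm_of_mem_nthRootsFinset hN0 hζ)]
      rw [Finset.sum_const, card_nthRootsFinset hN0.ne', nsmul_eq_mul]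
      rfl
    have h2 : circleAverage (fun η => ∑ ζ ∈ Polynomial.nthRootsFinset N (1 : ℂ), k (ζ * η)) 0 1 =
        circleAverage (fun η => (N : ℂ) * (((η ^ N) ^ m)⁻¹ * (ψ (η ^ N) : ℂ))) 0 1 := by
      apply circleAverage_congr_ae
      filter_upwards [h] with θ hθ
      have hθ' := congrArg (Complex.ofReal) hθ
      push_cast at hθ'
      rw [mul_left_comm, hθ', Finset.mul_sum]
      refine Finset.sum_congr rfl fun ζ hζ => ?_
      rw [Polynomial.mem_nthRootsFinset hN0] at hζ
      simp only [hk]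
      rw [mul_pow, pow_mul ζ, hζ, one_pow, one_mul, pow_mul]
    have h3 := circleAverage_comp_pow (k := fun η => (N : ℂ) * ((η ^ m)⁻¹ * (ψ η : ℂ)))
      ((circleIntegrable_pow_inv_mul hψ m).const_smul (a := (N : ℂ))) hN0.ne'
    have h4 : circleAverage (fun η => (N : ℂ) * ((η ^ m)⁻¹ * (ψ η : ℂ))) 0 1 =
        N * circleCoeff ψ m := by
      have := circleAverage_fun_smul (a := (N : ℂ)) (f := fun η => (η ^ m)⁻¹ * (ψ η : ℂ))
        (c := 0) (R := 1)
      simpa only [smul_eq_mul, circleCoeff] using this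
    have hNc : (N : ℂ) ≠ 0 := by exact_mod_cast hN0.ne'
    exact mul_left_cancel₀ hNc (h1.symm.trans (h2.trans (h3.trans h4)))
  have hiter : ∀ j, circleCoeff ψ (N ^ j * n) = circleCoeff ψ n := by
    intro j
    induction j with
    | zero => simp
    | succ j ih => rw [pow_succ', mul_assoc, hstep, ih]
  have hlim : Tendsto (fun j => N ^ j * n) atTop atTop :=
    (tendsto_pow_atTop_atTop_of_one_lt (by omega)).atTop_mul_const' (Nat.pos_of_ne_zero hn)
  have := (tendsto_circleCoeff ψ).comp hlim
  simp only [Function.comp_def, hiter] at this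
  exact tendsto_nhds_unique tendsto_const_nhds this

/-- Only the constant term of the power series `hasSum_schwarz` remains. -/
lemma schwarz_eq_const {ψ : ℂ → ℝ} (hψ : CircleIntegrable ψ 0 1)
    (h : ∀ n, n ≠ 0 → circleCoeff ψ n = 0) {z : ℂ} (hz : z ∈ disc) :
    schwarz ψ z = (circleAverage ψ 0 1 : ℝ) := by
  have h1 := hasSum_schwarz hψ hz
  simp only [h _ (Nat.succ_ne_zero _), mul_zero, zero_mul] at h1
  have h2 := h1.unique hasSum_zero
  rw [sub_eq_zero.1 h2, circleCoeff, circleAverage_def, circleAverage_def]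
  simp only [pow_zero, inv_one, one_mul, intervalIntegral.integral_ofReal, Complex.real_smul]
  push_cast
  simp

/-! ### Absence of zeros and analytic logarithms. -/

lemma pow_mem_disc {z : ℂ} (hz : z ∈ disc) {N : ℕ} (hN : N ≠ 0) : z ^ N ∈ disc := by
  have hz1 : ‖z‖ < 1 := by simpa using hz
  simpa using pow_lt_one₀ (norm_nonneg z) hz1 hN

/-- Solutions of the functional equation that do not vanish identically have no zeros. -/
theorem ne_zero_of_functionalEquation {N : ℕ} (hN : 2 ≤ N) {f : ℂ → ℂ}
    (hf : DifferentiableOn ℂ f disc) (hf0 : ∃ z ∈ disc, f z ≠ 0)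
    (hfe : SatisfiesFunctionalEquation N f) : ∀ z ∈ disc, f z ≠ 0 := by
  have hN0 : 0 < N := by omega
  have han : AnalyticOnNhd ℂ f disc := hf.analyticOnNhd Metric.isOpen_ball
  have h0mem : (0 : ℂ) ∈ disc := by simp [disc]
  have hpre : IsPreconnected disc := (convex_ball (0 : ℂ) 1).isPreconnected
  have hnfreq : ¬∃ᶠ z in 𝓝[≠] (0 : ℂ), f z = 0 := by
    intro hfr
    obtain ⟨z, hz, hfz⟩ := hf0
    exact hfz (han.eqOn_zero_of_preconnected_of_frequently_eq_zero hpre h0mem hfr hz)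
  have hzero : f 0 ≠ 0 := by
    intro hz
    obtain ⟨n, g, hg, hg0, hfg⟩ := (han 0 h0mem).exists_eventuallyEq_pow_smul_nonzero_iff.2
      (fun h => hnfreq (h.filter_mono nhdsWithin_le_nhds).frequently)
    simp only [sub_zero, smul_eq_mul] at hfg
    have hn : n ≠ 0 := by
      rintro rfl
      have := hfg.self_of_nhds
      simp only [pow_zero, one_mul] at this
      exact hg0 (this ▸ hz)
    have hgc := hg.continuousAt
    set P := Polynomial.nthRootsFinset N (1 : ℂ) with hP
    have hpow : Tendsto (fun z : ℂ => z ^ N) (𝓝 0) (𝓝 0) := by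
      have := (continuous_pow N (M := ℂ)).tendsto 0
      rwa [zero_pow hN0.ne'] at this
    have hmul : ∀ ζ : ℂ, Tendsto (fun z : ℂ => ζ * z) (𝓝 0) (𝓝 0) := fun ζ => by
      have := (continuous_const_mul ζ).tendsto 0
      rwa [mul_zero] at this
    have e1 : ∀ᶠ z in 𝓝 (0 : ℂ), f (z ^ N) = (z ^ N) ^ n * g (z ^ N) := hpow.eventually hfg
    have e2 : ∀ᶠ z in 𝓝 (0 : ℂ), ∀ ζ ∈ P, f (ζ * z) = (ζ * z) ^ n * g (ζ * z) :=
      (Finset.eventually_all P).2 fun ζ _ => (hmul ζ).eventually hfg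
    -- If `f` vanishes at `0` to order `n`, the left side of the functional equation has order `n
    -- N²` and the right side order `n N`. After cancelling `z^(nN)` the left side tends to `0` and
    -- the right side does not, because `n N (N - 1) > 0`.
    have e3 : ∀ᶠ z in 𝓝[≠] (0 : ℂ), z ^ (n * N * (N - 1)) * g (z ^ N) ^ N =
        (∏ ζ ∈ P, ζ ^ n) * ∏ ζ ∈ P, g (ζ * z) := by
      filter_upwards [e1.filter_mono nhdsWithin_le_nhds, e2.filter_mono nhdsWithin_le_nhds,
        nhdsWithin_le_nhds (Metric.isOpen_ball.mem_nhds h0mem), self_mem_nhdsWithin]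
        with z h1 h2 hz hz0
      have h := hfe z hz
      rw [h1, Finset.prod_congr rfl h2, Finset.prod_mul_distrib] at h
      simp only [mul_pow, Finset.prod_mul_distrib, Finset.prod_const] at h
      rw [card_nthRootsFinset hN0.ne'] at h
      have hz0' : z ≠ 0 := hz0
      apply mul_left_cancel₀ (pow_ne_zero (n * N) hz0')
      calc z ^ (n * N) * (z ^ (n * N * (N - 1)) * g (z ^ N) ^ N)
          = ((z ^ N) ^ n) ^ N * g (z ^ N) ^ N := by
            rw [← mul_assoc, ← pow_add, ← pow_mul, ← pow_mul]
            congr 2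
            obtain ⟨m, rfl⟩ : ∃ m, N = m + 1 := ⟨N - 1, by omega⟩
            simp only [Nat.add_sub_cancel]; ring
        _ = _ := by rw [h, ← pow_mul]; ring
    have l1 : Tendsto (fun z : ℂ => z ^ (n * N * (N - 1)) * g (z ^ N) ^ N) (𝓝[≠] 0) (𝓝 0) := by
      have hne : n * N * (N - 1) ≠ 0 := by
        refine mul_ne_zero (mul_ne_zero hn hN0.ne') (by omega)
      have a1 := (continuous_pow (n * N * (N - 1)) (M := ℂ)).tendsto 0
      rw [zero_pow hne] at a1
      have := a1.mul ((hgc.tendsto.comp hpow).pow N)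
      rw [zero_mul] at this
      exact this.mono_left nhdsWithin_le_nhds
    have l2 : Tendsto (fun z : ℂ => (∏ ζ ∈ P, ζ ^ n) * ∏ ζ ∈ P, g (ζ * z)) (𝓝[≠] 0)
        (𝓝 ((∏ ζ ∈ P, ζ ^ n) * ∏ _ζ ∈ P, g 0)) :=
      (Tendsto.const_mul _ (tendsto_finsetProd _ fun ζ _ => hgc.tendsto.comp (hmul ζ))).mono_left
        nhdsWithin_le_nhds
    have heq := tendsto_nhds_unique (l1.congr' e3) l2
    refine mul_ne_zero ?_ ?_ heq.symm
    · refine Finset.prod_ne_zero_iff.2 fun ζ hζ => pow_ne_zero _ ?_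
      have := norm_of_mem_nthRootsFinset hN0 hζ
      exact norm_ne_zero_iff.1 (by rw [this]; exact one_ne_zero)
    · exact Finset.prod_ne_zero_iff.2 fun _ _ => hg0
  intro w hw hfw
  have hw0 : w ≠ 0 := by rintro rfl; exact hzero hfw
  -- A zero at `w` kills the factor `ζ = 1`, so `f (w^N) = 0`. The iterated zeros tend to `0`
  -- without reaching it, against the identity theorem.
  have hit : ∀ j : ℕ, w ^ N ^ j ∈ disc ∧ f (w ^ N ^ j) = 0 := by
    intro j
    induction j with
    | zero => simpa using ⟨by simpa using hw, hfw⟩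
    | succ j ih =>
      rw [pow_succ, pow_mul]
      refine ⟨pow_mem_disc ih.1 hN0.ne', ?_⟩
      have h := hfe _ ih.1
      have h1 : (1 : ℂ) ∈ Polynomial.nthRootsFinset N (1 : ℂ) := by
        rw [Polynomial.mem_nthRootsFinset hN0]; simp
      rw [Finset.prod_eq_zero h1 (by rw [one_mul]; exact ih.2)] at h
      exact eq_zero_of_pow_eq_zero h
  have hw1 : ‖w‖ < 1 := by simpa using hw
  have hlim : Tendsto (fun j : ℕ => w ^ N ^ j) atTop (𝓝[≠] 0) := by
    refine tendsto_nhdsWithin_iff.2 ⟨?_, Eventually.of_forall fun j => pow_ne_zero _ hw0⟩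
    exact (tendsto_pow_atTop_nhds_zero_of_norm_lt_one hw1).comp
      (tendsto_pow_atTop_atTop_of_one_lt (by omega))
  exact hnfreq (hlim.frequently (Frequently.of_forall fun j => (hit j).2))

/-- Zero-free analytic functions on the disc have analytic logarithms. -/
theorem exists_log {f : ℂ → ℂ} (hf : DifferentiableOn ℂ f disc) (h0 : ∀ z ∈ disc, f z ≠ 0) :
    ∃ h : ℂ → ℂ, DifferentiableOn ℂ h disc ∧ ∀ z ∈ disc, f z = Complex.exp (h z) := by
  have h0mem : (0 : ℂ) ∈ disc := by simp [disc]
  have hd : DifferentiableOn ℂ (fun z => deriv f z / f z) disc :=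
    (hf.deriv Metric.isOpen_ball).div hf h0
  obtain ⟨h, hh0, hh⟩ := hd.isExactOn_ball.with_val_at 0 (Complex.log (f 0))
  have hhd : DifferentiableOn ℂ h disc :=
    fun z hz => (hh z hz).differentiableAt.differentiableWithinAt
  refine ⟨h, hhd, fun z hz => ?_⟩
  have hq : ∀ z ∈ disc, HasDerivAt (fun z => f z * Complex.exp (-h z)) 0 z := fun z hz => by
    have hfz := (hf.differentiableAt (Metric.isOpen_ball.mem_nhds hz)).hasDerivAt
    convert! hfz.mul (hh z hz).neg.cexp using 1
    field_simp [h0 z hz]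
    ring
  have hconst := (convex_ball (0 : ℂ) 1).is_const_of_fderivWithin_eq_zero (𝕜 := ℂ)
    (f := fun z => f z * Complex.exp (-h z))
    (fun z hz => (hq z hz).differentiableAt.differentiableWithinAt)
    (fun z hz => by
      rw [fderivWithin_of_isOpen Metric.isOpen_ball hz]
      ext
      simp [(hq z hz).deriv]) hz h0mem
  simp only [hh0, Complex.exp_neg, Complex.exp_log (h0 0 h0mem)] at hconst
  rw [mul_inv_cancel₀ (h0 0 h0mem)] at hconst
  exact (mul_inv_eq_one₀ (Complex.exp_ne_zero _)).1 hconst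

/-! ### Singular inner functions and boundary moduli. -/

lemma eventually_mem_Ioo : ∀ᶠ r : ℝ in 𝓝[<] 1, r ∈ Set.Ioo (0 : ℝ) 1 :=
  Ioo_mem_nhdsLT one_pos

lemma isSingularInner_of_ae_tendsto_norm {F : ℂ → ℂ} (hF : DifferentiableOn ℂ F disc)
    (hb : ∀ z ∈ disc, ‖F z‖ ≤ 1) (h0 : ∀ z ∈ disc, F z ≠ 0)
    (hlim : ∀ᵐ θ : ℝ, Tendsto (fun r : ℝ => ‖F (circleMap 0 r θ)‖) (𝓝[<] 1) (𝓝 1)) :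
    IsSingularInner F := by
  obtain ⟨g, hg⟩ := exists_isBoundaryFunction_of_bounded hF (M := 1) hb
  refine ⟨⟨hF, hb, g, hg, ?_⟩, h0⟩
  filter_upwards [hg, hlim] with θ h1 h2
  exact tendsto_nhds_unique h1.norm h2

lemma isSingularInner_exp_neg {K : ℂ → ℂ} (hK : DifferentiableOn ℂ K disc)
    (h0 : ∀ z ∈ disc, 0 ≤ (K z).re)
    (hlim : ∀ᵐ θ : ℝ, Tendsto (fun r : ℝ => (K (circleMap 0 r θ)).re) (𝓝[<] 1) (𝓝 0)) :
    IsSingularInner (fun z => Complex.exp (-K z)) := by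
  refine isSingularInner_of_ae_tendsto_norm hK.neg.cexp (fun z hz => ?_)
    (fun z _ => Complex.exp_ne_zero _) ?_
  · rw [Complex.norm_exp]; simpa using h0 z hz
  · filter_upwards [hlim] with θ h2
    have h3 := (Real.continuous_exp.tendsto _).comp h2.neg
    rw [neg_zero, Real.exp_zero] at h3
    refine h3.congr fun r => ?_
    rw [Complex.norm_exp, Complex.neg_re]; rfl

lemma IsSingularInner.ae_tendsto_norm {s : ℂ → ℂ} (hs : IsSingularInner s) :
    ∀ᵐ θ : ℝ, Tendsto (fun r : ℝ => ‖s (circleMap 0 r θ)‖) (𝓝[<] 1) (𝓝 1) := by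
  obtain ⟨⟨-, -, g, hg, hg1⟩, -⟩ := hs
  filter_upwards [hg, hg1] with θ h1 h2
  simpa only [h2] using h1.norm

lemma IsSingularInnerQuotient.ae_tendsto_norm {f : ℂ → ℂ} (hf : IsSingularInnerQuotient f) :
    ∀ᵐ θ : ℝ, Tendsto (fun r : ℝ => ‖f (circleMap 0 r θ)‖) (𝓝[<] 1) (𝓝 1) := by
  obtain ⟨s₁, s₂, h1, h2, heq⟩ := hf
  filter_upwards [h1.ae_tendsto_norm, h2.ae_tendsto_norm] with θ a b
  have := a.div b one_ne_zero
  rw [div_one] at this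
  refine this.congr' ?_
  filter_upwards [eventually_mem_Ioo] with r hr
  rw [heq _ (circleMap_mem_disc hr.1.le hr.2 θ), norm_div]
  rfl

lemma ae_tendsto_norm_of_const_mul {f : ℂ → ℂ} {c : ℝ} (hc : 0 < c)
    (h : ∀ᵐ θ : ℝ, Tendsto (fun r : ℝ => ‖(c : ℂ) * f (circleMap 0 r θ)‖) (𝓝[<] 1) (𝓝 1)) :
    ∀ᵐ θ : ℝ, Tendsto (fun r : ℝ => ‖f (circleMap 0 r θ)‖) (𝓝[<] 1) (𝓝 c⁻¹) := by
  filter_upwards [h] with θ hθ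
  have := hθ.const_mul c⁻¹
  rw [mul_one] at this
  refine this.congr fun r => ?_
  rw [norm_mul, Complex.norm_real, Real.norm_of_nonneg hc.le, inv_mul_cancel_left₀ hc.ne']

/-- Two almost everywhere statements hold together at some angle. This gives both uniqueness claims.
-/
lemma eq_of_ae_tendsto_norm {f : ℂ → ℂ} {c d : ℝ}
    (hc : ∀ᵐ θ : ℝ, Tendsto (fun r : ℝ => ‖f (circleMap 0 r θ)‖) (𝓝[<] 1) (𝓝 c⁻¹))
    (hd : ∀ᵐ θ : ℝ, Tendsto (fun r : ℝ => ‖f (circleMap 0 r θ)‖) (𝓝[<] 1) (𝓝 d⁻¹)) :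
    c = d := by
  obtain ⟨θ, h1, h2⟩ := (hc.and hd).exists
  exact inv_injective (tendsto_nhds_unique h1 h2)

lemma ae_comp_mul_left {p : ℝ → Prop} (h : ∀ᵐ θ : ℝ, p θ) {a : ℝ} (ha : a ≠ 0) :
    ∀ᵐ θ : ℝ, p (a * θ) := by
  have hq : Measure.QuasiMeasurePreserving (fun θ : ℝ => a * θ) volume volume := by
    refine ⟨measurable_const_mul a, ?_⟩
    rw [Real.map_volume_mul_left ha]
    exact Measure.smul_absolutelyContinuous
  exact hq.ae h

/-- The functional equation for the radial limits of the logarithm of the modulus. -/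
lemma ae_boundary_functionalEquation {N : ℕ} (hN : 0 < N) {u : ℂ → ℝ} {ψ : ℂ → ℝ}
    (hu : ∀ z ∈ disc, (N : ℝ) * u (z ^ N) = ∑ ζ ∈ Polynomial.nthRootsFinset N (1 : ℂ), u (ζ * z))
    (hψ : ∀ᵐ θ : ℝ, Tendsto (fun r : ℝ => u (circleMap 0 r θ)) (𝓝[<] 1)
      (𝓝 (ψ (circleMap 0 1 θ)))) :
    ∀ᵐ θ : ℝ, (N : ℝ) * ψ (circleMap 0 1 θ ^ N) =
      ∑ ζ ∈ Polynomial.nthRootsFinset N (1 : ℂ), ψ (ζ * circleMap 0 1 θ) := by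
  have hN' : (N : ℝ) ≠ 0 := by exact_mod_cast hN.ne'
  have h1 := ae_comp_mul_left hψ hN'
  have h2 : ∀ᵐ θ : ℝ, ∀ ζ ∈ Polynomial.nthRootsFinset N (1 : ℂ),
      Tendsto (fun r : ℝ => u (circleMap 0 r (θ + ζ.arg))) (𝓝[<] 1)
        (𝓝 (ψ (circleMap 0 1 (θ + ζ.arg)))) := by
    refine (Finset.eventually_all _).2 fun ζ _ => ?_
    exact (measurePreserving_add_right volume ζ.arg).quasiMeasurePreserving.ae hψ
  filter_upwards [h1, h2] with θ h1 h2
  -- The radial limit at `ζ^N` is taken along the radii `r^N`, which also tend to `1` from the left.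
  have hpow : Tendsto (fun r : ℝ => r ^ N) (𝓝[<] 1) (𝓝[<] 1) := by
    refine tendsto_nhdsWithin_iff.2 ⟨?_, ?_⟩
    · have := (continuous_pow N (M := ℝ)).tendsto 1
      rw [one_pow] at this
      exact this.mono_left nhdsWithin_le_nhds
    · filter_upwards [eventually_mem_Ioo] with r hr
      exact pow_lt_one₀ hr.1.le hr.2 hN.ne'
  have l1 := (h1.comp hpow).const_mul (N : ℝ)
  have l2 := tendsto_finsetSum _ h2
  rw [circleMap_pow, one_pow]
  rw [Finset.sum_congr rfl fun ζ hζ => by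
    rw [mul_circleMap_eq_circleMap_add (norm_of_mem_nthRootsFinset hN hζ)]]
  refine tendsto_nhds_unique l1 (l2.congr' ?_)
  filter_upwards [eventually_mem_Ioo] with r hr
  have := hu _ (circleMap_mem_disc hr.1.le hr.2 θ)
  rw [circleMap_pow] at this
  simp only [Function.comp_apply, this]
  exact Finset.sum_congr rfl fun ζ hζ => by
    rw [mul_circleMap_eq_circleMap_add (norm_of_mem_nthRootsFinset hN hζ)]

lemma posLog_norm_exp (w : ℂ) : posLog ‖Complex.exp w‖ = max w.re 0 := by
  rw [posLog, Complex.norm_exp, Real.log_exp, max_comm]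

/-! ### The quotient representation, the Smirnov case and the remaining factors. -/

/-- Existence of the singular inner quotient representation. -/
theorem exists_isSingularInnerQuotient {N : ℕ} (hN : 2 ≤ N) {f h : ℂ → ℂ} (hf : Nevanlinna f)
    (hfe : SatisfiesFunctionalEquation N f) (hh : DifferentiableOn ℂ h disc)
    (hfh : ∀ z ∈ disc, f z = Complex.exp (h z)) :
    ∃ c : ℝ, 0 < c ∧ IsSingularInnerQuotient (fun z => (c : ℂ) * f z) := by
  have hN0 : 0 < N := by omega
  obtain ⟨M, hM⟩ := hf.2
  obtain ⟨H, hH, hHh⟩ := exists_majorant hh (M := M) fun r hr => by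
    refine le_trans (le_of_eq ?_) (hM ⟨r, hr, rfl⟩)
    apply circleAverage_congr_sphere
    intro z hz
    have hz' : z ∈ disc := by
      rw [mem_sphere_zero_iff_norm, abs_of_nonneg hr.1] at hz
      simpa [hz] using hr.2
    simp only [hfh z hz', posLog_norm_exp]
  obtain ⟨ψ₂, hψ₂, hlim₂, hle₂⟩ := exists_boundary_re hH
    fun z hz => (le_max_right _ _).trans (hHh z hz)
  obtain ⟨ψ₁, hψ₁, hlim₁, hle₁⟩ := exists_boundary_re (H := fun z => H z - h z) (hH.sub hh)
    fun z hz => by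
      have := (le_max_left _ _).trans (hHh z hz)
      simpa using this
  have hψ : CircleIntegrable (fun ζ => ψ₂ ζ - ψ₁ ζ) 0 1 := hψ₂.sub hψ₁
  have hlim : ∀ᵐ θ : ℝ, Tendsto (fun r : ℝ => (h (circleMap 0 r θ)).re) (𝓝[<] 1)
      (𝓝 (ψ₂ (circleMap 0 1 θ) - ψ₁ (circleMap 0 1 θ))) := by
    filter_upwards [hlim₁, hlim₂] with θ h1 h2
    refine (h2.sub h1).congr fun r => ?_
    simp
  have hu : ∀ z ∈ disc, (N : ℝ) * (h (z ^ N)).re =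
      ∑ ζ ∈ Polynomial.nthRootsFinset N (1 : ℂ), (h (ζ * z)).re := fun z hz => by
    have e := congrArg (fun w => Real.log ‖w‖) (hfe z hz)
    simp only [norm_pow, Real.log_pow, norm_prod] at e
    have hlog : ∀ w ∈ disc, Real.log ‖f w‖ = (h w).re := fun w hw => by
      rw [hfh w hw, Complex.norm_exp, Real.log_exp]
    have hmem : ∀ ζ ∈ Polynomial.nthRootsFinset N (1 : ℂ), ζ * z ∈ disc := fun ζ hζ => by
      have := norm_of_mem_nthRootsFinset hN0 hζ
      simpa [this] using hz
    rw [Real.log_prod fun ζ hζ => by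
      rw [hfh _ (hmem ζ hζ)]; exact norm_ne_zero_iff.2 (Complex.exp_ne_zero _)] at e
    rw [hlog _ (pow_mem_disc hz hN0.ne')] at e
    rw [e]
    exact Finset.sum_congr rfl fun ζ hζ => hlog _ (hmem ζ hζ)
  have hbd := ae_boundary_functionalEquation hN0 (u := fun z => (h z).re)
    (ψ := fun ζ => ψ₂ ζ - ψ₁ ζ) hu hlim
  -- `ψ₂ - ψ₁` is the boundary function of `log |f|`; without nonconstant Fourier modes its Schwarz
  -- integral is its mean `A`.
  have hconst : ∀ z ∈ disc, schwarz ψ₂ z - schwarz ψ₁ z =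
      (circleAverage (fun ζ => ψ₂ ζ - ψ₁ ζ) 0 1 : ℝ) := fun z hz => by
    rw [← schwarz_sub hψ₂ hψ₁ hz]
    exact schwarz_eq_const hψ (fun n hn => circleCoeff_eq_zero hN hψ hbd hn) hz
  set A : ℝ := circleAverage (fun ζ => ψ₂ ζ - ψ₁ ζ) 0 1 with hA
  -- Each exponent removes from `H - h` or `H` the Schwarz integral of its boundary values. What
  -- remains has nonnegative real part and zero radial limits, and the difference of the two
  -- remainders is `h - A`.
  refine ⟨Real.exp (-A), Real.exp_pos _, fun z => Complex.exp (-(H z - h z - schwarz ψ₁ z)),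
    fun z => Complex.exp (-(H z - schwarz ψ₂ z)), ?_, ?_, fun z hz => ?_⟩
  · refine isSingularInner_exp_neg ((hH.sub hh).sub (differentiableOn_schwarz hψ₁))
      (fun z hz => ?_) ?_
    · have := hle₁ z hz
      simp only [Complex.sub_re] at this ⊢
      linarith
    · filter_upwards [hlim₁, ae_tendsto_re_schwarz hψ₁] with θ h1 h2
      simpa using h1.sub h2
  · refine isSingularInner_exp_neg (hH.sub (differentiableOn_schwarz hψ₂)) (fun z hz => ?_) ?_
    · have := hle₂ z hz
      simp only [Complex.sub_re] at this ⊢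
      linarith
    · filter_upwards [hlim₂, ae_tendsto_re_schwarz hψ₂] with θ h1 h2
      simpa using h1.sub h2
  · simp only [hfh z hz]
    rw [Complex.ofReal_exp, ← Complex.exp_add, ← Complex.exp_sub]
    congr 1
    push_cast
    rw [← hconst z hz]
    ring

/-- A zero-free Smirnov function whose boundary function has constant modulus is bounded by that
constant. -/
theorem norm_le_of_smirnov {f h : ℂ → ℂ} (hf : Smirnov f) (hh : DifferentiableOn ℂ h disc)
    (hfh : ∀ z ∈ disc, f z = Complex.exp (h z)) {a : ℝ} (ha : 0 < a)
    (hlim : ∀ᵐ θ : ℝ, Tendsto (fun r : ℝ => ‖f (circleMap 0 r θ)‖) (𝓝[<] 1) (𝓝 a)) :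
    ∀ z ∈ disc, ‖f z‖ ≤ a := by
  obtain ⟨-, g, hg, -, hlub⟩ := hf
  have hga : ∀ᵐ θ : ℝ, ‖g (circleMap 0 1 θ)‖ = a := by
    filter_upwards [hg, hlim] with θ h1 h2
    exact tendsto_nhds_unique h1.norm h2
  set L := posLog a with hL
  have hLavg : circleAverage (fun ζ => posLog ‖g ζ‖) 0 1 = L := by
    rw [circleAverage_congr_ae (l := fun _ => L) (hga.mono fun θ hθ => by simp only [hθ, hL])]
    exact circleAverage_const L 0 1
  rw [hLavg] at hlub
  set v : ℕ → ℂ → ℝ := fun n ζ => max (h (radius n * ζ)).re 0 with hv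
  have hvc : ∀ n, ContinuousOn (v n) (Metric.sphere 0 1) := fun n =>
    (Complex.continuous_re.comp_continuousOn (continuousOn_dilate_sphere hh
      (radius_nonneg n) (radius_lt_one n))).sup continuousOn_const
  have hvi : ∀ n, CircleIntegrable (v n) 0 1 := fun n => (hvc n).circleIntegrable zero_le_one
  have hv0 : ∀ n ζ, 0 ≤ v n ζ := fun n ζ => le_max_right _ _
  have hvf : ∀ n ζ, ‖ζ‖ ≤ 1 → v n ζ = posLog ‖f (radius n * ζ)‖ := fun n ζ hζ => by
    rw [hfh _ (smul_mem_disc (radius_nonneg n) (radius_lt_one n) hζ), posLog_norm_exp]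
  have hvavg : ∀ n, circleAverage (v n) 0 1 ≤ L := fun n => by
    refine le_trans (le_of_eq ?_) (hlub.1 ⟨radius n, ⟨radius_nonneg n, radius_lt_one n⟩, rfl⟩)
    simp only [circleAverage_def]
    congr 2; ext θ
    rw [hvf n _ (by simp), mul_circleMap, mul_one]
  have hvlim : ∀ᵐ θ : ℝ, Tendsto (fun n => v n (circleMap 0 1 θ)) atTop (𝓝 L) := by
    filter_upwards [hlim] with θ hθ
    have h1 := (continuous_posLog.tendsto a).comp (hθ.comp tendsto_radius_nhdsLT)
    refine h1.congr fun n => ?_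
    rw [hvf n _ (by simp), mul_circleMap, mul_one]
    rfl
  have hL0 : 0 ≤ L := posLog_nonneg
  -- A Scheffé argument: the negative part of `v n - L` is dominated by `L` and tends to `0` almost
  -- everywhere. Since the mean of `v n` is at most `L`, the mean of the positive part is no larger
  -- than that of the negative part, so it tends to `0` too.
  have hneg : Tendsto (fun n => circleAverage (fun ζ => max (L - v n ζ) 0) 0 1) atTop (𝓝 0) := by
    simp only [circleAverage_def]
    suffices hs : Tendsto (fun n => ∫ θ in (0 : ℝ)..2 * π, max (L - v n (circleMap 0 1 θ)) 0) atTop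
        (𝓝 (∫ _ in (0 : ℝ)..2 * π, (0 : ℝ))) by
      simpa using hs.const_smul ((2 * π)⁻¹ : ℝ)
    refine intervalIntegral.tendsto_integral_filter_of_dominated_convergence (fun _ => L)
      (Eventually.of_forall fun n => ?_) (Eventually.of_forall fun n => ae_of_all _ fun θ _ => ?_)
      (by simp) (hvlim.mono fun θ hθ _ => ?_)
    · exact (((continuousOn_const.sub (hvc n)).sup continuousOn_const).comp_continuous
        (continuous_circleMap 0 1) fun θ => by simp).aestronglyMeasurable
    · rw [Real.norm_of_nonneg (le_max_right _ _)]
      exact max_le (by linarith [hv0 n (circleMap 0 1 θ)]) hL0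
    · have := (hθ.const_sub L).max (tendsto_const_nhds (x := (0 : ℝ)))
      simpa using this
  have hposle : ∀ n, circleAverage (fun ζ => max (v n ζ - L) 0) 0 1 ≤
      circleAverage (fun ζ => max (L - v n ζ) 0) 0 1 := fun n => by
    have hi1 : CircleIntegrable (fun ζ => max (L - v n ζ) 0) 0 1 :=
      ((continuousOn_const.sub (hvc n)).sup continuousOn_const).circleIntegrable zero_le_one
    have e : (fun ζ => max (v n ζ - L) 0) = fun ζ => (v n ζ - L) + max (L - v n ζ) 0 := by
      ext ζ
      rcases le_total (v n ζ) L with hle | hle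
      · rw [max_eq_right (by linarith), max_eq_left (by linarith)]; ring
      · rw [max_eq_left (by linarith), max_eq_right (by linarith)]; ring
    have hi2 : CircleIntegrable (fun ζ => v n ζ - L) 0 1 :=
      (hvi n).sub (circleIntegrable_const L 0 1)
    rw [e, circleAverage_fun_add hi2 hi1,
      circleAverage_fun_sub (hvi n) (circleIntegrable_const L 0 1), circleAverage_const]
    linarith [hvavg n]
  have hvL : ∀ z ∈ disc, max (h z).re 0 ≤ L := by
    intro z hz
    have hz1 : ‖z‖ < 1 := by simpa using hz
    have hP := continuousOn_poissonKernel hz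
    -- `B` bounds the Poisson kernel at `z`, so the Poisson integral of `v n` exceeds `L` by at most
    -- `B` times the mean of `max (v n - L) 0`.
    set B := (1 + ‖z‖) / (1 - ‖z‖) with hB
    have hbound : ∀ n, max (h (radius n * z)).re 0 ≤
        L + B * circleAverage (fun ζ => max (L - v n ζ) 0) 0 1 := fun n => by
      refine (max_re_le_circleAverage hh (radius_nonneg n) (radius_lt_one n) hz).trans ?_
      have hB0 : 0 ≤ B := div_nonneg (by positivity) (by linarith)
      have hi2 : CircleIntegrable (fun ζ => B * max (v n ζ - L) 0) 0 1 :=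
        (continuousOn_const.mul (((hvc n).sub continuousOn_const).sup continuousOn_const)
          ).circleIntegrable zero_le_one
      have hi3 : CircleIntegrable (fun ζ => L * poissonKernel 0 z ζ) 0 1 :=
        (continuousOn_const.mul hP).circleIntegrable zero_le_one
      have e1 : circleAverage (fun ζ => L * poissonKernel 0 z ζ) 0 1 = L := by
        have := circleAverage_fun_smul (a := L) (f := fun ζ => poissonKernel 0 z ζ)
          (c := 0) (R := 1)
        simp only [smul_eq_mul] at this
        rw [this, circleAverage_poissonKernel hz, mul_one]
      have e2 : circleAverage (fun ζ => B * max (v n ζ - L) 0) 0 1 =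
          B * circleAverage (fun ζ => max (v n ζ - L) 0) 0 1 := by
        have := circleAverage_fun_smul (a := B) (f := fun ζ => max (v n ζ - L) 0)
          (c := 0) (R := 1)
        simpa only [smul_eq_mul] using this
      calc circleAverage (fun ζ => poissonKernel 0 z ζ * max (h (radius n * ζ)).re 0) 0 1
          ≤ circleAverage (fun ζ => L * poissonKernel 0 z ζ + B * max (v n ζ - L) 0) 0 1 := by
            refine circleAverage_mono ((hP.mul (hvc n)).circleIntegrable zero_le_one)
              (hi3.add hi2) fun ζ hζ => ?_
            have hζ1 : ‖ζ‖ = 1 := by simpa using hζ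
            have p0 := poissonKernel_nonneg hz hζ1
            have p1 := poissonKernel_le hz hζ1
            have m1 := le_max_left (v n ζ - L) 0
            have m0 := le_max_right (v n ζ - L) 0
            change poissonKernel 0 z ζ * v n ζ ≤ _
            nlinarith [mul_le_mul_of_nonneg_left m1 p0, mul_le_mul_of_nonneg_right p1 m0]
        _ = L + B * circleAverage (fun ζ => max (v n ζ - L) 0) 0 1 := by
            rw [circleAverage_fun_add hi3 hi2, e1, e2]
        _ ≤ _ := by linarith [mul_le_mul_of_nonneg_left (hposle n) hB0]
    have l1 : Tendsto (fun n => max (h (radius n * z)).re 0) atTop (𝓝 (max (h z).re 0)) :=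
      ((Complex.continuous_re.tendsto _).comp (tendsto_radius_mul hh hz)).max tendsto_const_nhds
    have l2 := (hneg.const_mul B).const_add L
    rw [mul_zero, add_zero] at l2
    exact le_of_tendsto_of_tendsto' l1 l2 hbound
  have hlogle : ∀ z ∈ disc, (h z).re ≤ Real.log a := by
    -- For `a ≥ 1` the bound `L` is already `log a`. For `a ≤ 1` the positive part only shows `Re h
    -- ≤ 0`; then `-h` has nonnegative real part, and the Poisson integral of its boundary value
    -- `-log a` minorizes it.
    rcases le_total 1 a with h1 | h1
    · intro z hz
      have : L = Real.log a := posLog_eq_log (by rwa [abs_of_pos ha])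
      exact this ▸ (le_max_left _ _).trans (hvL z hz)
    · have hL00 : L = 0 := posLog_eq_zero_iff a |>.2 (by rwa [abs_of_pos ha])
      obtain ⟨ψ, hψ, hψlim, hψle⟩ := exists_boundary_re (H := fun z => -h z) hh.neg fun z hz => by
        have := (le_max_left _ _).trans (hvL z hz)
        rw [hL00] at this
        simpa using this
      have hψa : ∀ᵐ θ : ℝ, ψ (circleMap 0 1 θ) = -Real.log a := by
        filter_upwards [hψlim, hlim] with θ b1 b2
        refine tendsto_nhds_unique b1 ((b2.log ha.ne').neg.congr' ?_)
        filter_upwards [eventually_mem_Ioo] with r hr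
        rw [hfh _ (circleMap_mem_disc hr.1.le hr.2 θ), Complex.norm_exp, Real.log_exp,
          Complex.neg_re]
      intro z hz
      have hz' := hψle z hz
      rw [re_schwarz hψ hz, circleAverage_congr_ae
        (l := fun ζ => (-Real.log a) * poissonKernel 0 z ζ)
        (hψa.mono fun θ hθ => by simp only [hθ]; ring)] at hz'
      have := circleAverage_fun_smul (a := -Real.log a) (f := fun ζ => poissonKernel 0 z ζ)
        (c := 0) (R := 1)
      simp only [smul_eq_mul] at this
      rw [this, circleAverage_poissonKernel hz, mul_one, Complex.neg_re] at hz'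
      linarith
  intro z hz
  rw [hfh z hz, Complex.norm_exp, ← Real.exp_log ha]
  exact Real.exp_le_exp.2 (hlogle z hz)

/-- A Blaschke product without zeros is trivial. -/
theorem IsBlaschkeProduct.eq_one {b : ℂ → ℂ} (hb : IsBlaschkeProduct b)
    (h0 : ∀ z ∈ disc, b z ≠ 0) : ∀ z ∈ disc, b z = 1 := by
  obtain ⟨ρ, -, hρ⟩ := hb
  have hzero : ∀ w ∈ disc, ρ w = 0 := by
    intro w hw
    by_contra hne
    apply h0 w hw
    rw [hρ w hw]
    by_cases hw0 : w = 0
    · subst hw0; simp [hne]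
    -- Every finite partial product containing the index `w` is zero at `w`, so the infinite product
    -- converges to `0` there without any appeal to the Blaschke condition.
    · refine mul_eq_zero_of_right _ (HasProd.tprod_eq ?_)
      refine tendsto_const_nhds.congr' ?_
      rw [SummationFilter.unconditional_filter]
      filter_upwards [eventually_ge_atTop {⟨w, hw, hw0⟩}] with s hs
      refine (Finset.prod_eq_zero (i := ⟨w, hw, hw0⟩) (by simpa using hs) ?_).symm
      simp [hne]
  intro z hz
  rw [hρ z hz, hzero 0 (by simp [disc]), pow_zero, one_mul]
  have : ∀ w : {w : ℂ // w ∈ disc ∧ w ≠ 0},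
      ((‖(w : ℂ)‖ : ℂ) / w * ((w - z) / (1 - (starRingEnd ℂ) w * z))) ^ ρ w = 1 := fun w => by
    rw [hzero w w.2.1, pow_zero]
  simp only [this, tprod_one]

/-- An outer function whose modulus has constant radial limits almost everywhere is constant. -/
theorem IsOuter.eq_const {o : ℂ → ℂ} (ho : IsOuter o) {a : ℝ} (ha : 0 < a)
    (hlim : ∀ᵐ θ : ℝ, Tendsto (fun r : ℝ => ‖o (circleMap 0 r θ)‖) (𝓝[<] 1) (𝓝 a)) :
    ∃ c : ℂ, ∀ z ∈ disc, o z = c := by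
  obtain ⟨ω, hω, ψ, hψ, ho⟩ := ho
  have hψa : ∀ᵐ θ : ℝ, ψ (circleMap 0 1 θ) = Real.log a := by
    filter_upwards [ae_tendsto_re_schwarz hψ, hlim] with θ h1 h2
    refine tendsto_nhds_unique h1 ((h2.log ha.ne').congr' ?_)
    filter_upwards [eventually_mem_Ioo] with r hr
    rw [ho _ (circleMap_mem_disc hr.1.le hr.2 θ), norm_mul, hω, one_mul, Complex.norm_exp,
      Real.log_exp]
    rfl
  -- A constant satisfies the functional equation trivially, here with `N = 2`, so the Fourier
  -- argument applies to the almost everywhere constant `ψ`.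
  have hcoef : ∀ n, n ≠ 0 → circleCoeff ψ n = 0 := fun n hn => by
    refine circleCoeff_eq_zero le_rfl hψ ?_ hn
    exact ae_boundary_functionalEquation (u := fun _ => Real.log a) two_pos
      (fun z _ => by simp [card_nthRootsFinset]) (hψa.mono fun θ hθ => by
        rw [hθ]; exact tendsto_const_nhds)
  exact ⟨ω * Complex.exp (circleAverage ψ 0 1 : ℝ), fun z hz => by
    rw [ho z hz, ← schwarz_eq_const hψ hcoef hz]; rfl⟩

end DiscFunction

/-! ### The main theorem. -/

theorem theorem5 (N : ℕ) (hN : 2 ≤ N) (f : ℂ → ℂ)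
    (hf : DiscFunction.Nevanlinna f) (hf0 : ∃ z ∈ DiscFunction.disc, f z ≠ 0)
    (hfe : DiscFunction.SatisfiesFunctionalEquation N f) :
    (∃! c : ℝ, 0 < c ∧ DiscFunction.IsSingularInnerQuotient (fun z => (c : ℂ) * f z)) ∧
    (DiscFunction.Smirnov f →
      ∃! c : ℝ, 0 < c ∧ DiscFunction.IsSingularInner (fun z => (c : ℂ) * f z)) ∧
    (∀ b s₁ s₂ o : ℂ → ℂ, DiscFunction.IsBlaschkeProduct b → DiscFunction.IsSingularInner s₁ →
      DiscFunction.IsSingularInner s₂ → DiscFunction.IsOuter o →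
      (∀ z ∈ DiscFunction.disc, f z = b z * (s₁ z / s₂ z) * o z) →
      (∀ z ∈ DiscFunction.disc, b z = 1) ∧ ∃ a : ℂ, ∀ z ∈ DiscFunction.disc, o z = a) := by
  open DiscFunction Filter Topology in
  have hne := ne_zero_of_functionalEquation hN hf.1 hf0 hfe
  obtain ⟨h, hh, hfh⟩ := exists_log hf.1 hne
  obtain ⟨c, hc, hcq⟩ := exists_isSingularInnerQuotient hN hf hfe hh hfh
  have hlim := ae_tendsto_norm_of_const_mul hc hcq.ae_tendsto_norm
  refine ⟨⟨c, ⟨hc, hcq⟩, fun d hd => ?_⟩, fun hS => ⟨c, ⟨hc, ?_⟩, fun d hd => ?_⟩, ?_⟩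
  · exact eq_of_ae_tendsto_norm (ae_tendsto_norm_of_const_mul hd.1 hd.2.ae_tendsto_norm) hlim
  · have hle := norm_le_of_smirnov hS hh hfh (inv_pos.2 hc) hlim
    refine isSingularInner_of_ae_tendsto_norm (hf.1.const_mul _) (fun z hz => ?_)
      (fun z hz => mul_ne_zero (by exact_mod_cast hc.ne') (hne z hz)) hcq.ae_tendsto_norm
    rw [norm_mul, Complex.norm_real, Real.norm_of_nonneg hc.le]
    calc c * ‖f z‖ ≤ c * c⁻¹ := mul_le_mul_of_nonneg_left (hle z hz) hc.le
      _ = 1 := mul_inv_cancel₀ hc.ne'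
  · exact eq_of_ae_tendsto_norm (ae_tendsto_norm_of_const_mul hd.1 hd.2.ae_tendsto_norm) hlim
  · intro b s₁ s₂ o hb h₁ h₂ ho heq
    have hb1 := hb.eq_one fun z hz h0 => hne z hz (by rw [heq z hz, h0]; simp)
    refine ⟨hb1, ho.eq_const (inv_pos.2 hc) ?_⟩
    filter_upwards [hlim, h₁.ae_tendsto_norm, h₂.ae_tendsto_norm] with θ l l₁ l₂
    -- With `b = 1` one has `|o| = |f| |s₂| / |s₁|`, whose radial limit is `c⁻¹` almost everywhere.
    have := (l.mul l₂).div l₁ one_ne_zero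
    rw [mul_one, div_one] at this
    refine this.congr' ?_
    filter_upwards [eventually_mem_Ioo] with r hr
    have hz := circleMap_mem_disc hr.1.le hr.2 θ
    have n₁ := norm_ne_zero_iff.2 (h₁.2 _ hz)
    have n₂ := norm_ne_zero_iff.2 (h₂.2 _ hz)
    simp only [Pi.div_apply, heq _ hz, hb1 _ hz, norm_mul, norm_div, norm_one]
    field_simp
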